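/- Let $V$ be a finite-dimensional vector space over a field $K$ and let $\Delta$ be a finite subgroup of $\mathrm{GL}(V)$ whose order is invertible in $K$. An element $g\in\mathrm{GL}(V)$ is called a pseudoreflection if $g-1$ has rank $1$. Let $S(V)$ be the symmetric algebra of $V$, let $P(V)$ be its completion at the maximal ideal $\bigoplus_{n\ge 1}S^n(V)$, and let $\mathfrak m$ be the maximal ideal of $P(V)$. The action of $\Delta$ on $V$ induces actions on $S(V)$ and on $P(V)$; let $S(V)^{\Delta}$ and $P(V)^{\Delta}$ be the $K$-subalgebras of invariants and let $\mathfrak n=\mathfrak m\cap P(V)^{\Delta}$. Then the following conditions are equivalent: 1. $\Delta$ is generated by pseudoreflections; 2. $S(V)^{\Delta}$ is a polynomial algebra over $K$ (in finitely many variables); 3. $S(V)$ is a free $S(V)^{\Delta}$-module; 4. $P(V)^{\Delta}$, with its $\mathfrak n$-adic topology, is formally smooth over $K$ (with the discrete topology); that is, for every commutative discrete $K$-algebra $C$ and every ideal $J\subset C$ with $J^2=0$, every continuous $K$-algebra homomorphism $P(V)^{\Delta}\to C/J$ lifts to a continuous $K$-algebra homomorphism $P(V)^{\Delta}\to C$.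 -/

import Mathlib

universe u v

noncomputable section

namespace CST

section General

variable (K : Type u) {A : Type v} [Field K] [CommRing A] [Algebra K A]

/-- `A`, with the `I`-adic topology, is formally smooth over the discrete field `K`:
for every discrete commutative `K`-algebra `C` and every square-zero ideal `J` of `C`, each
continuous `K`-algebra homomorphism `A → C ⧸ J` lifts to a continuous one `A → C`.
A homomorphism from `A` to a discrete ring is continuous iff it kills a power of `I`. -/
def IsAdicFormallySmooth (I : Ideal A) : Prop :=
  ∀ (C : Type (max u v)) [CommRing C] [Algebra K C] (J : Ideal C), J ^ 2 = ⊥ →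
    ∀ f : A →ₐ[K] C ⧸ J, (∃ n : ℕ, I ^ n ≤ RingHom.ker f) →
      ∃ g : A →ₐ[K] C, (∃ n : ℕ, I ^ n ≤ RingHom.ker g) ∧ (Ideal.Quotient.mkₐ K J).comp g = f

/-- `A` is isomorphic, as a `K`-algebra, to a polynomial algebra in finitely many variables. -/
def IsPolynomialAlgebra (A : Type v) [CommRing A] [Algebra K A] : Prop :=
  ∃ n : ℕ, Nonempty (MvPolynomial (Fin n) K ≃ₐ[K] A)

/-- The subalgebra of elements fixed by all `φ g`, `g ∈ Δ`, for an action `φ` of a group `G` by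
algebra endomorphisms and a subgroup `Δ` of `G`. -/
def invariants {K : Type u} [Field K] [Algebra K A] {G : Type*} [Group G] (φ : G →* (A →ₐ[K] A))
    (Δ : Subgroup G) : Subalgebra K A where
  carrier := {x | ∀ g ∈ Δ, φ g x = x}
  mul_mem' hx hy g hg := by rw [map_mul, hx g hg, hy g hg]
  add_mem' hx hy g hg := by rw [map_add, hx g hg, hy g hg]
  algebraMap_mem' r g _ := (φ g).commutes r

end General

variable (K : Type u) (V : Type v) [Field K] [AddCommGroup V] [Module K V]

variable {K V} in
/-- `g ∈ GL(V)` is a pseudoreflection if `g - 1` has rank one. -/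
def IsPseudoreflection (g : LinearMap.GeneralLinearGroup K V) : Prop :=
  Module.finrank K (LinearMap.range ((g : V →ₗ[K] V) - 1)) = 1

/-- The action of `GL(V)` on the symmetric algebra `S(V)`, extending the action on `V`. -/
def symAction : LinearMap.GeneralLinearGroup K V →*
    (SymmetricAlgebra K V →ₐ[K] SymmetricAlgebra K V) where
  toFun g := SymmetricAlgebra.lift (SymmetricAlgebra.ι K V ∘ₗ (g : V →ₗ[K] V))
  map_one' := by
    apply SymmetricAlgebra.algHom_ext
    ext x
    simp
  map_mul' g h := by
    apply SymmetricAlgebra.algHom_ext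
    ext x
    simp

@[simp]
theorem symAction_ι (g : LinearMap.GeneralLinearGroup K V) (x : V) :
    symAction K V g (SymmetricAlgebra.ι K V x) = SymmetricAlgebra.ι K V ((g : V →ₗ[K] V) x) := by
  simp [symAction]

/-- The ideal `⨁_{n ≥ 1} Sⁿ(V)` of `S(V)`: the kernel of the algebra map `S(V) → K` that sends
`V` to zero. -/
def augIdeal : Ideal (SymmetricAlgebra K V) :=
  RingHom.ker (SymmetricAlgebra.algebraMapInv (R := K) (M := V))

theorem augIdeal_le_comap (g : LinearMap.GeneralLinearGroup K V) :
    augIdeal K V ≤ (augIdeal K V).comap (symAction K V g) := by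
  have h : (SymmetricAlgebra.algebraMapInv (R := K) (M := V)).comp (symAction K V g) =
      SymmetricAlgebra.algebraMapInv := by
    apply SymmetricAlgebra.algHom_ext
    ext x
    simp [SymmetricAlgebra.algebraMapInv_ι]
  intro x hx
  have hx' : SymmetricAlgebra.algebraMapInv x = (0 : K) := hx
  change SymmetricAlgebra.algebraMapInv (symAction K V g x) = (0 : K)
  rw [← hx']
  exact DFunLike.congr_fun h x

theorem augIdeal_pow_le_comap (g : LinearMap.GeneralLinearGroup K V) (n : ℕ) :
    augIdeal K V ^ n ≤ (augIdeal K V ^ n).comap (symAction K V g) :=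
  (Ideal.pow_right_mono (augIdeal_le_comap K V g) n).trans (Ideal.le_comap_pow _ n)

/-- `P(V)`: the completion of `S(V)` at the ideal `⨁_{n ≥ 1} Sⁿ(V)`. -/
abbrev CompletedSym : Type (max u v) :=
  AdicCompletion (augIdeal K V) (SymmetricAlgebra K V)

/-- The projection `P(V) → S(V) ⧸ (⨁_{i ≥ 1} Sⁱ(V))ⁿ`. -/
def proj (n : ℕ) : CompletedSym K V →ₐ[K] SymmetricAlgebra K V ⧸ augIdeal K V ^ n where
  __ := (AdicCompletion.evalₐ (augIdeal K V) n).toRingHom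
  commutes' r := (AdicCompletion.evalₐ (augIdeal K V) n).commutes
    (algebraMap K (SymmetricAlgebra K V) r)

/-- The endomorphism of `S(V) ⧸ (⨁_{i ≥ 1} Sⁱ(V))ⁿ` induced by `g ∈ GL(V)`. -/
def quotAction (g : LinearMap.GeneralLinearGroup K V) (n : ℕ) :
    SymmetricAlgebra K V ⧸ augIdeal K V ^ n →ₐ[K] SymmetricAlgebra K V ⧸ augIdeal K V ^ n :=
  Ideal.quotientMapₐ _ (symAction K V g) (augIdeal_pow_le_comap K V g n)

theorem quotAction_proj_compatible (g : LinearMap.GeneralLinearGroup K V) {m n : ℕ} (hle : m ≤ n) :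
    (Ideal.Quotient.factorₐ K (Ideal.pow_le_pow_right hle)).comp
      ((quotAction K V g n).comp (proj K V n)) = (quotAction K V g m).comp (proj K V m) := by
  ext x
  obtain ⟨y, rfl⟩ := AdicCompletion.mk_surjective _ _ x
  have hy : (Ideal.Quotient.mk (augIdeal K V ^ m)) (y.val n) =
      (Ideal.Quotient.mk (augIdeal K V ^ m)) (y.val m) :=
    (AdicCompletion.Ideal.mk_eq_mk (augIdeal K V) hle y)
  have h1 : ∀ k, proj K V k (AdicCompletion.mk _ _ y) = Ideal.Quotient.mk _ (y.val k) :=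
    fun k => AdicCompletion.evalₐ_mk _ k y
  simp only [AlgHom.comp_apply, h1]
  rw [← hy]
  rfl

/-- The endomorphism of `P(V)` induced by `g ∈ GL(V)`: the inverse limit of the endomorphisms of
the quotients `S(V) ⧸ (⨁_{i ≥ 1} Sⁱ(V))ⁿ`. -/
def completedMap (g : LinearMap.GeneralLinearGroup K V) :
    CompletedSym K V →ₐ[K] CompletedSym K V :=
  AdicCompletion.liftAlgHom (augIdeal K V) (fun n => (quotAction K V g n).comp (proj K V n))
    (quotAction_proj_compatible K V g)

theorem proj_completedMap (g : LinearMap.GeneralLinearGroup K V) (n : ℕ) (x : CompletedSym K V) :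
    proj K V n (completedMap K V g x) = quotAction K V g n (proj K V n x) :=
  AdicCompletion.evalₐ_liftAlgHom _ _ (quotAction_proj_compatible K V g) n x

/-- The action of `GL(V)` on `P(V)` induced by its action on `V`. -/
def completedAction : LinearMap.GeneralLinearGroup K V →*
    (CompletedSym K V →ₐ[K] CompletedSym K V) where
  toFun g := completedMap K V g
  map_one' := by
    ext1 x
    refine AdicCompletion.ext_evalₐ fun n => ?_
    refine (proj_completedMap K V 1 n x).trans ?_
    obtain ⟨y, hy⟩ := Ideal.Quotient.mk_surjective (proj K V n x)
    rw [← hy]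
    change Ideal.Quotient.mk _ (symAction K V 1 y) = _
    rw [map_one]
    exact hy
  map_mul' g h := by
    ext1 x
    refine AdicCompletion.ext_evalₐ fun n => ?_
    refine (proj_completedMap K V (g * h) n x).trans ?_
    refine Eq.trans ?_ (proj_completedMap K V g n (completedMap K V h x)).symm
    rw [proj_completedMap]
    obtain ⟨y, hy⟩ := Ideal.Quotient.mk_surjective (proj K V n x)
    rw [← hy]
    change Ideal.Quotient.mk _ (symAction K V (g * h) y) =
      Ideal.Quotient.mk _ (symAction K V g (symAction K V h y))
    rw [map_mul]
    rfl

/-- The maximal ideal `𝔪` of `P(V)`: the kernel of `P(V) → S(V) ⧸ ⨁_{n ≥ 1} Sⁿ(V) = K`. -/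
def completedMaxIdeal : Ideal (CompletedSym K V) :=
  RingHom.ker (AdicCompletion.evalOneₐ (augIdeal K V))

variable {K V}

/-- `S(V)^Δ`. -/
abbrev symInvariants (Δ : Subgroup (LinearMap.GeneralLinearGroup K V)) :
    Subalgebra K (SymmetricAlgebra K V) :=
  invariants (symAction K V) Δ

/-- `P(V)^Δ`. -/
abbrev completedInvariants (Δ : Subgroup (LinearMap.GeneralLinearGroup K V)) :
    Subalgebra K (CompletedSym K V) :=
  invariants (completedAction K V) Δ

/-- The maximal ideal `𝔫 = 𝔪 ∩ P(V)^Δ` of `P(V)^Δ`. -/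
def invariantsMaxIdeal (Δ : Subgroup (LinearMap.GeneralLinearGroup K V)) :
    Ideal (completedInvariants Δ) :=
  (completedMaxIdeal K V).comap (completedInvariants Δ).val

end CST

end

/-! The implications proved are 1 → 3 → 2 → 4 → 1. Write S = S(V), R = S^Δ, ε for the constant term,
R₊ = ker ε ∩ R, and 𝔥 = R₊S for the Hilbert ideal.

1 → 3 is Chevalley's argument. A pseudoreflection moves every element of S by a multiple of one
linear form, so induction on degree and averaging show that syzygies over S between invariants are
generated by invariant ones (`syzygy_mem_span`). Homogeneous lifts of a K-basis of S/𝔥 are then an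
R-basis of S.

Both 3 and 4 yield the bound dim R₊/R₊² ≤ dim V (`CotangentRankLE`). Under 3, a Koszul argument
shows that elements of R₊ independent modulo squares lift to vectors with nonzero wedge product in
an exterior algebra of rank dim V (`card_le_finrank_of_free`). Under 4, lifting a truncated map
through all K[X]/(X)^k shows that such elements are algebraically independent
(`algebraicIndependent_of_isAdicFormallySmooth`). The bound gives at most dim V homogeneous
generators of R; as S is integral over R, transcendence degree forces exactly dim V independent
ones, which is 2.

2 → 4: a polynomial algebra is formally smooth, and R is dense in P(V)^Δ with compatible
truncations, because the powers of 𝔥 and of the augmentation ideal define the same topology.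

4 → 1: let H be the subgroup generated by the pseudoreflections of Δ. By the previous steps S^H and
S^Δ are both polynomial in dim V variables. The Jacobian of the generators of S^Δ with respect to
those of S^H is a unit: at a principal prime, inertia is generated by pseudoreflections, hence lies
in H (`jacobian_injective`). Its invertibility at the origin makes the generators of S^Δ generate
S^H, so S^H = S^Δ and H = Δ. -/

noncomputable section

namespace CST

open Polynomial Finset

/-! ### Averaging over a finite group. -/

section Reynolds

variable {K : Type*} {A : Type*} [Field K] [CommRing A] [Algebra K A] {G : Type*} [Group G]
  (φ : G →* (A →ₐ[K] A)) (Δ : Subgroup G) [Fintype Δ]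

/-- The averaging operator of a finite group of algebra endomorphisms. -/
def reynolds : A →ₗ[K] A :=
  (Fintype.card Δ : K)⁻¹ • ∑ g : Δ, (φ g).toLinearMap

theorem reynolds_apply (x : A) :
    reynolds φ Δ x = (Fintype.card Δ : K)⁻¹ • ∑ g : Δ, φ g x := by
  simp [reynolds]

theorem sum_action_mem (x : A) : ∑ g : Δ, φ g x ∈ invariants φ Δ := by
  intro h hh
  rw [map_sum]
  refine Fintype.sum_equiv (Equiv.mulLeft (⟨h, hh⟩ : Δ)) _ _ fun g => ?_
  simp [map_mul]

theorem reynolds_mem (x : A) : reynolds φ Δ x ∈ invariants φ Δ := by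
  rw [reynolds_apply]
  exact Subalgebra.smul_mem _ (sum_action_mem φ Δ x) _

theorem reynolds_mul {r : A} (hr : r ∈ invariants φ Δ) (x : A) :
    reynolds φ Δ (r * x) = r * reynolds φ Δ x := by
  rw [reynolds_apply, reynolds_apply, mul_smul_comm, mul_sum]
  congr 1
  refine sum_congr rfl fun g _ => ?_
  rw [map_mul, hr g g.2]

theorem reynolds_eq_self (hΔ : (Fintype.card Δ : K) ≠ 0) {r : A} (hr : r ∈ invariants φ Δ) :
    reynolds φ Δ r = r := by
  rw [reynolds_apply, sum_congr rfl fun g _ => hr g.1 g.2, sum_const, card_univ,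
    ← Nat.cast_smul_eq_nsmul K, smul_smul, inv_mul_cancel₀ hΔ, one_smul]

end Reynolds

/-! ### The grading of S(V) and graded subalgebras. -/

variable {K : Type u} {V : Type v} [Field K] [AddCommGroup V] [Module K V]

/-- The algebra map `S(V) → S(V)[X]` sending `v` to `vX`; its coefficients are the homogeneous
components. -/
def gr : SymmetricAlgebra K V →ₐ[K] (SymmetricAlgebra K V)[X] :=
  SymmetricAlgebra.lift ((Polynomial.monomial 1).restrictScalars K ∘ₗ SymmetricAlgebra.ι K V)

theorem gr_ι (x : V) : gr (SymmetricAlgebra.ι K V x) = monomial 1 (SymmetricAlgebra.ι K V x) := by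
  simp [gr]

theorem map_gr (g : LinearMap.GeneralLinearGroup K V) (x : SymmetricAlgebra K V) :
    mapAlgHom (symAction K V g) (gr x) = gr (symAction K V g x) := by
  have : (mapAlgHom (symAction K V g)).comp gr = gr.comp (symAction K V g) := by
    apply SymmetricAlgebra.algHom_ext
    ext1 v
    simp [gr_ι]
  exact DFunLike.congr_fun this x

theorem aeval_one_gr (x : SymmetricAlgebra K V) : (gr x).eval 1 = x := by
  have : ((aeval (R := SymmetricAlgebra K V) 1).restrictScalars K).comp gr =
      AlgHom.id K (SymmetricAlgebra K V) := by
    apply SymmetricAlgebra.algHom_ext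
    ext1 v
    simp [gr_ι]
  simpa [coe_aeval_eq_eval] using DFunLike.congr_fun this x

theorem gr_injective : Function.Injective (gr (K := K) (V := V)) := fun x y h => by
  rw [← aeval_one_gr x, h, aeval_one_gr]

/-- The homogeneous component of degree `d`. -/
def component (d : ℕ) : SymmetricAlgebra K V →ₗ[K] SymmetricAlgebra K V :=
  (lcoeff (SymmetricAlgebra K V) d).restrictScalars K ∘ₗ gr.toLinearMap

theorem component_apply (d : ℕ) (x : SymmetricAlgebra K V) : component d x = (gr x).coeff d := rfl

theorem component_mul (d : ℕ) (x y : SymmetricAlgebra K V) :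
    component d (x * y) = ∑ p ∈ antidiagonal d, component p.1 x * component p.2 y := by
  simp [component_apply, coeff_mul]

theorem component_symAction (d : ℕ) (g : LinearMap.GeneralLinearGroup K V)
    (x : SymmetricAlgebra K V) :
    component d (symAction K V g x) = symAction K V g (component d x) := by
  rw [component_apply, ← map_gr, component_apply]
  simp

theorem component_zero (x : SymmetricAlgebra K V) :
    component 0 x = algebraMap K _ (SymmetricAlgebra.algebraMapInv x) := by
  have : ((aeval (R := SymmetricAlgebra K V) 0).restrictScalars K).comp gr =
      (Algebra.ofId K (SymmetricAlgebra K V)).comp SymmetricAlgebra.algebraMapInv := by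
    apply SymmetricAlgebra.algHom_ext
    ext1 v
    simp [gr_ι, SymmetricAlgebra.algebraMapInv_ι]
  simpa [coe_aeval_eq_eval, component_apply, coeff_zero_eq_eval_zero, Algebra.ofId_apply] using
    DFunLike.congr_fun this x

/-- This makes `component d` a projection onto the elements with `gr x = monomial d x`, the notion
of homogeneity used throughout; zero is homogeneous of every degree. -/
theorem gr_component (d : ℕ) (x : SymmetricAlgebra K V) :
    gr (component d x) = monomial d (component d x) := by
  induction x using SymmetricAlgebra.induction generalizing d with
  | algebraMap r =>
    rw [component_apply, AlgHom.commutes, Polynomial.algebraMap_apply, coeff_C]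
    split_ifs with h
    · subst h
      rw [AlgHom.commutes, Polynomial.algebraMap_apply]
      rfl
    · simp
  | ι v =>
    rw [component_apply, gr_ι, coeff_monomial]
    split_ifs with h
    · subst h
      exact gr_ι v
    · simp
  | mul a b ha hb =>
    rw [component_mul, map_sum, map_sum]
    refine sum_congr rfl fun p hp => ?_
    rw [map_mul, ha, hb, monomial_mul_monomial, HasAntidiagonal.mem_antidiagonal.mp hp]
  | add a b ha hb => rw [map_add, map_add, ha, hb, map_add]

theorem component_of_gr_eq {d : ℕ} {x : SymmetricAlgebra K V} (hx : gr x = monomial d x) (e : ℕ) :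
    component e x = if d = e then x else 0 := by
  rw [component_apply, hx, coeff_monomial]

theorem sum_component (x : SymmetricAlgebra K V) :
    ∑ d ∈ range ((gr x).natDegree + 1), component d x = x := by
  conv_rhs => rw [← aeval_one_gr x, eval_eq_sum_range]
  simp [component_apply]

theorem mem_augIdeal {x : SymmetricAlgebra K V} :
    x ∈ augIdeal K V ↔ SymmetricAlgebra.algebraMapInv x = (0 : K) := Iff.rfl

theorem component_zero_of_mem {x : SymmetricAlgebra K V} (hx : x ∈ augIdeal K V) :
    component 0 x = 0 := by
  rw [component_zero, mem_augIdeal.mp hx, map_zero]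

theorem component_mem_augIdeal {d : ℕ} (hd : d ≠ 0) (x : SymmetricAlgebra K V) :
    component d x ∈ augIdeal K V := by
  have h := component_of_gr_eq (gr_component d x) 0
  rw [if_neg hd, component_zero] at h
  exact (SymmetricAlgebra.algebraMap_eq_zero_iff V _).mp h

theorem component_mem_augIdeal' {x : SymmetricAlgebra K V} (hx : x ∈ augIdeal K V) (d : ℕ) :
    component d x ∈ augIdeal K V := by
  rcases eq_or_ne d 0 with rfl | hd
  · rw [component_zero_of_mem hx]
    exact zero_mem _
  · exact component_mem_augIdeal hd x

theorem algebraMapInv_symAction (g : LinearMap.GeneralLinearGroup K V)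
    (x : SymmetricAlgebra K V) : SymmetricAlgebra.algebraMapInv (symAction K V g x) =
      (SymmetricAlgebra.algebraMapInv x : K) := by
  have h : (SymmetricAlgebra.algebraMapInv (R := K) (M := V)).comp (symAction K V g) =
      SymmetricAlgebra.algebraMapInv := by
    apply SymmetricAlgebra.algHom_ext
    ext x
    simp [SymmetricAlgebra.algebraMapInv_ι]
  exact DFunLike.congr_fun h x

theorem ι_ne_zero {a : V} (ha : a ≠ 0) : SymmetricAlgebra.ι K V a ≠ 0 := by
  intro h
  refine ha ((Module.forall_dual_apply_eq_zero_iff K a).mp fun f => ?_)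
  rw [← SymmetricAlgebra.lift_ι_apply f a, h, map_zero]

theorem ι_injective : Function.Injective (SymmetricAlgebra.ι K V) := by
  rw [injective_iff_map_eq_zero]
  intro a h
  by_contra ha
  exact ι_ne_zero ha h

theorem symAction_injective : Function.Injective (symAction K V) := by
  intro g h hgh
  ext v
  apply ι_injective (K := K)
  rw [← symAction_ι, ← symAction_ι, hgh]

/-- A subalgebra of `S(V)` containing the homogeneous components of its elements. -/
def IsGraded (B : Subalgebra K (SymmetricAlgebra K V)) : Prop :=
  ∀ x ∈ B, ∀ d, component d x ∈ B

theorem isGraded_symInvariants (Δ : Subgroup (LinearMap.GeneralLinearGroup K V)) :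
    IsGraded (symInvariants Δ) := by
  intro x hx d g hg
  rw [← component_symAction, hx g hg]

/-- The elements of a subalgebra without constant term. -/
def posPart (B : Subalgebra K (SymmetricAlgebra K V)) : Submodule K (SymmetricAlgebra K V) :=
  B.toSubmodule ⊓ (augIdeal K V).restrictScalars K

theorem mem_posPart {B : Subalgebra K (SymmetricAlgebra K V)} {x : SymmetricAlgebra K V} :
    x ∈ posPart B ↔ x ∈ B ∧ x ∈ augIdeal K V := Iff.rfl

theorem sub_algebraMapInv_mem_posPart {B : Subalgebra K (SymmetricAlgebra K V)}
    {x : SymmetricAlgebra K V} (hx : x ∈ B) :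
    x - algebraMap K _ (SymmetricAlgebra.algebraMapInv x) ∈ posPart B :=
  ⟨sub_mem hx (B.algebraMap_mem _), by
    change SymmetricAlgebra.algebraMapInv _ = (0 : K)
    rw [map_sub, AlgHom.commutes]
    simp⟩

/-- A graded subalgebra is generated by homogeneous elements which span its positive part modulo
squares. -/
theorem adjoin_eq_of_posPart_le {B : Subalgebra K (SymmetricAlgebra K V)} (hB : IsGraded B)
    {ι : Type*} (f : ι → SymmetricAlgebra K V) (hf : ∀ i, f i ∈ B)
    (hom : ∀ i, ∃ d, gr (f i) = monomial d (f i))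
    (h : posPart B ≤ Submodule.span K (Set.range f) ⊔ posPart B * posPart B) :
    Algebra.adjoin K (Set.range f) = B := by
  have hle : Algebra.adjoin K (Set.range f) ≤ B :=
    Algebra.adjoin_le (by rintro _ ⟨i, rfl⟩; exact hf i)
  refine le_antisymm hle ?_
  have key : ∀ d, ∀ x ∈ B, component d x ∈ Algebra.adjoin K (Set.range f) := by
    intro d
    induction d using Nat.strong_induction_on with
    | _ d ih =>
      intro x hx
      rcases eq_or_ne d 0 with rfl | hd
      · rw [component_zero]
        exact Subalgebra.algebraMap_mem _ _
      have h1 := h (mem_posPart.mpr ⟨hB x hx d, component_mem_augIdeal hd x⟩)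
      -- Taking the degree `d` component once more discards all other degrees. In a product of two
      -- elements without constant term only factors of degree strictly below `d` survive, and these
      -- are covered by induction.
      have h2 : component d (component d x) ∈ Algebra.adjoin K (Set.range f) := by
        obtain ⟨y, hy, z, hz, hyz⟩ := Submodule.mem_sup.mp h1
        rw [← hyz, map_add]
        refine add_mem ?_ ?_
        · refine Submodule.span_induction ?_ ?_ ?_ ?_ hy
          · rintro _ ⟨i, rfl⟩
            obtain ⟨e, he⟩ := hom i
            rw [component_of_gr_eq he]
            split_ifs
            · exact Algebra.subset_adjoin ⟨i, rfl⟩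
            · exact zero_mem _
          · rw [map_zero]
            exact zero_mem _
          · intro a b _ _ ha hb
            rw [map_add]
            exact add_mem ha hb
          · intro c a _ ha
            rw [map_smul]
            exact Subalgebra.smul_mem _ ha c
        · refine Submodule.mul_induction_on hz ?_ ?_
          · intro a ha b hb
            rw [component_mul]
            refine sum_mem fun p hp => ?_
            rw [HasAntidiagonal.mem_antidiagonal] at hp
            rcases eq_or_ne p.1 0 with h0 | h0
            · rw [h0, component_zero_of_mem ha.2, zero_mul]
              exact zero_mem _
            rcases eq_or_ne p.2 0 with h0' | h0'
            · rw [h0', component_zero_of_mem hb.2, mul_zero]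
              exact zero_mem _
            exact mul_mem (ih _ (by omega) a ha.1) (ih _ (by omega) b hb.1)
          · intro a b ha hb
            rw [map_add]
            exact add_mem ha hb
      rwa [component_of_gr_eq (gr_component d x), if_pos rfl] at h2
  intro x hx
  rw [← sum_component x]
  exact sum_mem fun d _ => key d x hx

end CST

end

/-! ### Chevalley's argument: reflection groups give free modules. -/

noncomputable section

namespace CST

open Polynomial Finset

variable {K : Type u} {V : Type v} [Field K] [AddCommGroup V] [Module K V]

theorem IsPseudoreflection.exists_vector {s : LinearMap.GeneralLinearGroup K V}
    (hs : IsPseudoreflection s) :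
    ∃ a : V, a ≠ 0 ∧ ∀ v, ∃ c : K, (s : V →ₗ[K] V) v - v = c • a := by
  obtain ⟨⟨a, ha⟩, ha0, h⟩ := finrank_eq_one_iff'.mp hs
  refine ⟨a, fun h0 => ha0 (Subtype.ext h0), fun v => ?_⟩
  obtain ⟨c, hc⟩ := h ⟨((s : V →ₗ[K] V) - 1) v, LinearMap.mem_range_self _ v⟩
  exact ⟨c, (congrArg Subtype.val hc).symm⟩

/-- Modulo `ι a` the automorphism fixes all the generators, hence everything. -/
theorem ι_dvd_symAction_sub {s : LinearMap.GeneralLinearGroup K V} {a : V}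
    (h : ∀ v, ∃ c : K, (s : V →ₗ[K] V) v - v = c • a) (x : SymmetricAlgebra K V) :
    SymmetricAlgebra.ι K V a ∣ symAction K V s x - x := by
  induction x using SymmetricAlgebra.induction with
  | algebraMap r => simp
  | ι v =>
    obtain ⟨c, hc⟩ := h v
    rw [symAction_ι, ← map_sub, hc, map_smul]
    exact Dvd.intro (c • 1) (by simp)
  | mul x y hx hy =>
    have : symAction K V s (x * y) - x * y =
        symAction K V s x * (symAction K V s y - y) + (symAction K V s x - x) * y := by
      rw [map_mul]
      ring
    rw [this]
    exact dvd_add (hy.mul_left _) (hx.mul_right _)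
  | add x y hx hy =>
    have : symAction K V s (x + y) - (x + y) =
        (symAction K V s x - x) + (symAction K V s y - y) := by
      rw [map_add]
      ring
    rw [this]
    exact dvd_add hx hy

theorem degree_gr_symAction_le (g : LinearMap.GeneralLinearGroup K V)
    (x : SymmetricAlgebra K V) : (gr (symAction K V g x)).degree ≤ (gr x).degree := by
  rw [← map_gr]
  exact degree_map_le

/-- Chevalley's lemma: for a group generated by pseudoreflections, relations over `S(V)` between
invariants come from relations over the invariants. -/
theorem syzygy_mem_span (Δ : Subgroup (LinearMap.GeneralLinearGroup K V)) [Fintype Δ]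
    (hΔ : (Fintype.card Δ : K) ≠ 0)
    (hgen : Subgroup.closure {g | g ∈ Δ ∧ IsPseudoreflection g} = Δ)
    {ι : Type*} [Fintype ι] (f : ι → SymmetricAlgebra K V) (hf : ∀ i, f i ∈ symInvariants Δ)
    (y : ι → SymmetricAlgebra K V) (hy : ∑ i, f i * y i = 0) :
    y ∈ Submodule.span (SymmetricAlgebra K V)
      {v : ι → SymmetricAlgebra K V | (∀ i, v i ∈ symInvariants Δ) ∧ ∑ i, f i * v i = 0} := by
  set N := Submodule.span (SymmetricAlgebra K V)
      {v : ι → SymmetricAlgebra K V | (∀ i, v i ∈ symInvariants Δ) ∧ ∑ i, f i * v i = 0} with hN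
  have main : ∀ d : ℕ, ∀ y : ι → SymmetricAlgebra K V, (∀ i, (gr (y i)).degree < d) →
      ∑ i, f i * y i = 0 → y ∈ N := by
    intro d
    induction d with
    | zero =>
      intro y hd _
      have : y = 0 := by
        ext i
        refine gr_injective ?_
        rw [Pi.zero_apply, map_zero, ← degree_eq_bot]
        exact Nat.WithBot.lt_zero_iff.mp (by simpa using hd i)
      rw [this]
      exact zero_mem _
    | succ d ih =>
      have act : ∀ g ∈ Δ, ∀ y : ι → SymmetricAlgebra K V, ∑ i, f i * y i = 0 →
          ∑ i, f i * symAction K V g (y i) = 0 := by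
        intro g hg y hy
        rw [← map_zero (symAction K V g), ← hy, map_sum]
        refine sum_congr rfl fun i _ => ?_
        rw [map_mul, hf i g hg]
      -- The group acts trivially on syzygies of this degree modulo `N`. This property passes to
      -- products and inverses, so only pseudoreflections need an argument: there the difference is
      -- `ι a • z`, with `z` a syzygy of lower degree because S(V) is a domain.
      have step : ∀ g ∈ Δ, ∀ y : ι → SymmetricAlgebra K V,
          (∀ i, (gr (y i)).degree < (d + 1 : ℕ)) → ∑ i, f i * y i = 0 →
          (fun i => symAction K V g (y i)) - y ∈ N := by
        intro g hg
        rw [← hgen] at hg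
        induction hg using Subgroup.closure_induction with
        | mem s hs =>
          intro y hd hy
          obtain ⟨a, ha, hsa⟩ := hs.2.exists_vector
          choose z hz using fun i => ι_dvd_symAction_sub hsa (y i)
          have h0 := ι_ne_zero (K := K) ha
          have hzN : z ∈ N := by
            refine ih z (fun i => ?_) ?_
            · have h1 : (gr (symAction K V s (y i) - y i)).degree < (d + 1 : ℕ) := by
                rw [map_sub]
                exact (degree_sub_le _ _).trans_lt
                  (max_lt ((degree_gr_symAction_le s _).trans_lt (hd i)) (hd i))
              rw [hz i, map_mul, degree_mul, gr_ι, degree_monomial _ h0] at h1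
              rcases hb : (gr (z i)).degree with _ | m
              · exact WithBot.bot_lt_coe d
              · rw [hb] at h1
                have h2 : ((1 + m : ℕ) : WithBot ℕ) < ((d + 1 : ℕ) : WithBot ℕ) := h1
                have h3 : 1 + m < d + 1 := by exact_mod_cast h2
                exact WithBot.coe_lt_coe.mpr (by omega : m < d)
            · refine (mul_eq_zero.mp ?_).resolve_left h0
              rw [mul_sum, sum_congr rfl fun i _ => (mul_left_comm _ (f i) (z i)),
                sum_congr rfl fun i _ => by rw [← hz i, mul_sub], sum_sub_distrib,
                act s hs.1 y hy, hy, sub_zero]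
          have : (fun i => symAction K V s (y i)) - y = SymmetricAlgebra.ι K V a • z := by
            ext i
            simp [hz i]
          rw [this]
          exact N.smul_mem _ hzN
        | one =>
          intro y _ _
          rw [map_one]
          simp
        | mul g h hg hh ihg ihh =>
          intro y hd hy
          rw [hgen] at hg hh
          have h1 := ihg (fun i => symAction K V h (y i))
            (fun i => (degree_gr_symAction_le h _).trans_lt (hd i)) (act h hh y hy)
          have h2 := add_mem h1 (ihh y hd hy)
          rw [sub_add_sub_cancel] at h2
          rw [map_mul]
          exact h2
        | inv g hg ihg =>
          intro y hd hy
          rw [hgen] at hg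
          have h1 := ihg (fun i => symAction K V g⁻¹ (y i))
            (fun i => (degree_gr_symAction_le _ _).trans_lt (hd i)) (act _ (inv_mem hg) y hy)
          have h2 : ∀ x, symAction K V g (symAction K V g⁻¹ x) = x := fun x => by
            rw [← AlgHom.mul_apply, ← map_mul, mul_inv_cancel, map_one, AlgHom.one_apply]
          simp only [h2] at h1
          rw [← neg_sub]
          exact neg_mem h1
      intro y hd hy
      -- The sum of `y` over the group is an invariant syzygy, and it is congruent to `|Δ| • y`
      -- modulo `N`; the order is invertible.
      have h1 : ∑ g : Δ, ((fun i => symAction K V g (y i)) - y) ∈ N :=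
        sum_mem fun g _ => step g g.2 y hd hy
      have h2 : (fun i => ∑ g : Δ, symAction K V g (y i)) ∈ N := by
        refine Submodule.subset_span ⟨fun i => sum_action_mem _ _ _, ?_⟩
        simp only [mul_sum]
        rw [sum_comm]
        exact sum_eq_zero fun g _ => act g g.2 y hy
      have h3 : (Fintype.card Δ : K) • y ∈ N := by
        have h4 := sub_mem h2 h1
        rw [sum_sub_distrib, sum_const, card_univ, ← Nat.cast_smul_eq_nsmul K] at h4
        convert h4 using 1
        ext i
        simp
      have h4 := Submodule.smul_of_tower_mem N (Fintype.card Δ : K)⁻¹ h3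
      rwa [smul_smul, inv_mul_cancel₀ hΔ, one_smul] at h4
  obtain ⟨d, hd⟩ : ∃ d : ℕ, ∀ i, (gr (y i)).degree < d := by
    refine ⟨(∑ i, (gr (y i)).natDegree) + 1, fun i => degree_le_natDegree.trans_lt ?_⟩
    have : (gr (y i)).natDegree ≤ ∑ i, (gr (y i)).natDegree :=
      single_le_sum (f := fun i => (gr (y i)).natDegree) (fun _ _ => Nat.zero_le _) (mem_univ i)
    exact_mod_cast Nat.lt_succ_of_le this
  exact main d y hd hy

/-- The Hilbert ideal: the ideal of `S(V)` generated by the invariants without constant term. -/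
def hilbertIdeal (Δ : Subgroup (LinearMap.GeneralLinearGroup K V)) :
    Ideal (SymmetricAlgebra K V) :=
  Ideal.span (posPart (symInvariants Δ))

theorem hilbertIdeal_le (Δ : Subgroup (LinearMap.GeneralLinearGroup K V)) :
    hilbertIdeal Δ ≤ augIdeal K V :=
  Ideal.span_le.mpr fun _ hx => hx.2

theorem sub_smul_mem_hilbertIdeal {Δ : Subgroup (LinearMap.GeneralLinearGroup K V)}
    {r : SymmetricAlgebra K V} (hr : r ∈ symInvariants Δ) (x : SymmetricAlgebra K V) :
    x * r - (SymmetricAlgebra.algebraMapInv r : K) • x ∈ hilbertIdeal Δ := by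
  have : x * r - (SymmetricAlgebra.algebraMapInv r : K) • x =
      x * (r - algebraMap K _ (SymmetricAlgebra.algebraMapInv r)) := by
    rw [Algebra.smul_def]
    ring
  rw [this]
  exact Ideal.mul_mem_left _ _ (Ideal.subset_span (sub_algebraMapInv_mem_posPart hr))

/-- By Chevalley's lemma `y = ∑ h j • v j` with the `v j` invariant syzygies of `r`, the rows of a
matrix `A` with `A r = 0`. If `ε(A) c = 0`, then `∑ c i • y i` is congruent to zero modulo the
Hilbert ideal, so `c = 0`. Hence `ε(A)` has a left inverse `w`, the determinant of `w A` has
constant term 1, and it is nonzero in a domain, which kills `r`. -/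
theorem linearIndependent_of_hilbertIdeal (Δ : Subgroup (LinearMap.GeneralLinearGroup K V))
    [Fintype Δ] (hΔ : (Fintype.card Δ : K) ≠ 0)
    (hgen : Subgroup.closure {g | g ∈ Δ ∧ IsPseudoreflection g} = Δ)
    {ι : Type*} [Fintype ι] [DecidableEq ι] (y : ι → SymmetricAlgebra K V)
    (hy : ∀ c : ι → K, ∑ i, c i • y i ∈ hilbertIdeal Δ → c = 0)
    (r : ι → symInvariants Δ) (hr : ∑ i, (r i : SymmetricAlgebra K V) * y i = 0) : r = 0 := by
  obtain ⟨k, h, v, hv⟩ := Submodule.mem_span_set'.mp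
    (syzygy_mem_span Δ hΔ hgen (fun i => (r i : SymmetricAlgebra K V)) (fun i => (r i).2) y hr)
  let ε : symInvariants Δ →ₐ[K] K := SymmetricAlgebra.algebraMapInv.comp (symInvariants Δ).val
  let A : Matrix (Fin k) ι (symInvariants Δ) := Matrix.of fun j i => ⟨(v j).1 i, (v j).2.1 i⟩
  have hA : A.mulVec r = 0 := by
    ext j
    simp only [Matrix.mulVec, dotProduct, A, Matrix.of_apply, Pi.zero_apply]
    push_cast
    exact (sum_congr rfl fun i _ => mul_comm _ _).trans (v j).2.2
  have hinj : LinearMap.ker (A.map ε).mulVecLin = ⊥ := by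
    rw [LinearMap.ker_eq_bot']
    intro c hc
    refine hy c ?_
    have h1 : ∀ i, y i - ∑ j, (ε (A j i)) • h j ∈ hilbertIdeal Δ := by
      intro i
      rw [← hv, Finset.sum_apply, ← sum_sub_distrib]
      exact sum_mem fun j _ => sub_smul_mem_hilbertIdeal ((v j).2.1 i) (h j)
    have h2 : ∑ i, c i • (y i - ∑ j, (ε (A j i)) • h j) ∈ hilbertIdeal Δ :=
      sum_mem fun i _ => Submodule.smul_of_tower_mem _ _ (h1 i)
    have h3 : ∑ i, c i • ∑ j, (ε (A j i)) • h j = 0 := by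
      simp only [smul_sum, smul_smul]
      rw [sum_comm]
      refine sum_eq_zero fun j _ => ?_
      rw [← sum_smul]
      have h4 : ∑ i, c i * ε (A j i) = 0 := by
        have := congrFun hc j
        simp only [Matrix.mulVecLin_apply, Matrix.mulVec, dotProduct, Pi.zero_apply,
          Matrix.map_apply] at this
        rw [← this]
        exact sum_congr rfl fun i _ => mul_comm _ _
      rw [h4, zero_smul]
    simp only [smul_sub] at h2
    rwa [sum_sub_distrib, h3, sub_zero] at h2
  obtain ⟨w, hw⟩ : ∃ w : Matrix ι (Fin k) K, w * A.map ε = 1 := by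
    obtain ⟨g, hg⟩ := LinearMap.exists_leftInverse_of_injective _ hinj
    refine ⟨LinearMap.toMatrix' g, ?_⟩
    rw [← Matrix.toLin'_apply'] at hg
    rw [← LinearMap.toMatrix'_toLin' (A.map ε), ← LinearMap.toMatrix'_comp, hg,
      LinearMap.toMatrix'_id]
  let w' : Matrix ι (Fin k) (symInvariants Δ) := w.map (algebraMap K _)
  have hdet : (w' * A).det ≠ 0 := by
    intro h0
    have h1 := congrArg ε h0
    rw [map_zero] at h1
    have h2 : ε (w' * A).det = ((w' * A).map ε).det := AlgHom.map_det ε _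
    have h3 : (w' * A).map ε = w * A.map ε := by
      rw [Matrix.map_mul]
      congr 1
      ext i j
      simp [w']
    rw [h2, h3, hw, Matrix.det_one] at h1
    exact one_ne_zero h1
  refine Matrix.eq_zero_of_mulVec_eq_zero hdet ?_
  rw [← Matrix.mulVec_mulVec, hA, Matrix.mulVec_zero]

theorem exists_sum_mul_of_mem_hilbertIdeal {Δ : Subgroup (LinearMap.GeneralLinearGroup K V)}
    {x : SymmetricAlgebra K V} (hx : x ∈ hilbertIdeal Δ) :
    ∃ (k : ℕ) (s r : Fin k → SymmetricAlgebra K V), (∀ j, r j ∈ posPart (symInvariants Δ)) ∧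
      x = ∑ j, s j * r j := by
  obtain ⟨k, s, r, h⟩ := Submodule.mem_span_set'.mp hx
  exact ⟨k, s, fun j => r j, fun j => (r j).2, h.symm⟩

/-- Graded Nakayama: homogeneous lifts of a basis modulo the Hilbert ideal span by induction on
degree, since each correction term has a factor of positive degree in the invariants. Independence
is `linearIndependent_of_hilbertIdeal`. -/
theorem free_of_closure_pseudoreflection (Δ : Subgroup (LinearMap.GeneralLinearGroup K V))
    [Fintype Δ] (hΔ : (Fintype.card Δ : K) ≠ 0)
    (hgen : Subgroup.closure {g | g ∈ Δ ∧ IsPseudoreflection g} = Δ) :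
    Module.Free (symInvariants Δ) (SymmetricAlgebra K V) := by
  let q : SymmetricAlgebra K V →ₗ[K] SymmetricAlgebra K V ⧸ hilbertIdeal Δ :=
    (Ideal.Quotient.mkₐ K (hilbertIdeal Δ)).toLinearMap
  have hq : ∀ x, q x = 0 ↔ x ∈ hilbertIdeal Δ := fun x => Ideal.Quotient.eq_zero_iff_mem
  obtain ⟨b, hb, hspan, hli⟩ := exists_linearIndependent K
    (q '' {x | ∃ d, gr x = monomial d x})
  have hb' : ∀ a, a ∈ b → ∃ x, (∃ d, gr x = monomial d x) ∧ q x = a := fun a ha => hb ha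
  choose! y hy using hb'
  have hspan' : Submodule.span (symInvariants Δ) (Set.range fun i : b => y i) = ⊤ := by
    have key : ∀ d, ∀ x, component d x ∈
        Submodule.span (symInvariants Δ) (Set.range fun i : b => y i) := by
      intro d
      induction d using Nat.strong_induction_on with
      | _ d ih =>
        intro x
        have h1 : q (component d x) ∈ Submodule.span K b := by
          rw [hspan]
          exact Submodule.subset_span ⟨_, ⟨d, gr_component d x⟩, rfl⟩
        have h2 : ∃ z ∈ Submodule.span K (y '' b), q z = q (component d x) := by
          have : b = q '' (y '' b) := by
            rw [Set.image_image]
            conv_lhs => rw [← Set.image_id b]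
            exact Set.image_congr fun i hi => (hy i hi).2.symm
          rw [this, Submodule.span_image] at h1
          exact h1
        obtain ⟨z, hz, hzq⟩ := h2
        obtain ⟨k, s, r, hr, hsr⟩ := exists_sum_mul_of_mem_hilbertIdeal
          ((hq (component d x - z)).mp (by rw [map_sub, hzq, sub_self]))
        have h3 : component d x = component d z + ∑ j, component d (s j * r j) := by
          rw [← map_sum, ← hsr, ← map_add, add_sub_cancel,
            component_of_gr_eq (gr_component d x), if_pos rfl]
        rw [h3]
        refine add_mem ?_ (sum_mem fun j _ => ?_)
        · refine Submodule.span_induction ?_ ?_ ?_ ?_ hz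
          · rintro _ ⟨i, hi, rfl⟩
            obtain ⟨e, he⟩ := (hy i hi).1
            rw [component_of_gr_eq he]
            split_ifs
            · exact Submodule.subset_span ⟨⟨i, hi⟩, rfl⟩
            · exact zero_mem _
          · rw [map_zero]
            exact zero_mem _
          · intro a b _ _ ha hb
            rw [map_add]
            exact add_mem ha hb
          · intro c a _ ha
            rw [map_smul]
            exact Submodule.smul_of_tower_mem _ c ha
        · rw [component_mul]
          refine sum_mem fun p hp => ?_
          rw [HasAntidiagonal.mem_antidiagonal] at hp
          rcases eq_or_ne p.2 0 with h0 | h0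
          · rw [h0, component_zero_of_mem (hr j).2, mul_zero]
            exact zero_mem _
          · rw [mul_comm]
            exact Submodule.smul_mem _
              (⟨component p.2 (r j), isGraded_symInvariants Δ _ (hr j).1 _⟩ : symInvariants Δ)
              (ih p.1 (by omega) (s j))
    rw [eq_top_iff]
    intro x _
    rw [← sum_component x]
    exact sum_mem fun d _ => key d x
  have hli' : LinearIndependent (symInvariants Δ) fun i : b => y i := by
    classical
    rw [linearIndependent_iff']
    intro t c hc i hi
    have h1 := linearIndependent_of_hilbertIdeal Δ hΔ hgen (fun i : t => y i.1) (fun a ha => ?_)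
      (fun i : t => c i.1) (by
        rw [← hc, ← sum_coe_sort t]
        rfl)
    · exact congrFun h1 ⟨i, hi⟩
    · have h2 : ∑ i : t, a i • ((i : b) : SymmetricAlgebra K V ⧸ hilbertIdeal Δ) = 0 := by
        rw [← (hq _).mpr ha, map_sum]
        refine sum_congr rfl fun i _ => ?_
        rw [map_smul, (hy i.1 i.1.2).2]
      have h3 := (Fintype.linearIndependent_iff.mp
        (hli.comp (Subtype.val : t → b) Subtype.val_injective)) a h2
      exact funext h3
  exact Module.Free.of_basis (Module.Basis.mk hli' hspan'.ge)

end CST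

end

/-! ### Koszul argument: freeness bounds the cotangent space. -/

noncomputable section

namespace CST

open Polynomial Finset

section Exterior

variable {S : Type*} [CommRing S]

instance exteriorAlgebra_free {E : Type*} [AddCommGroup E] [Module S E] [Module.Free S E] :
    Module.Free S (ExteriorAlgebra S E) :=
  Module.Free.of_equiv (DirectSum.decomposeLinearEquiv fun i : ℕ => ⋀[S]^i E).symm

/-- The product `w (k-1) * ⋯ * w 0` in the exterior algebra. -/
def wedge {E : Type*} [AddCommGroup E] [Module S E] (w : ℕ → E) : ℕ → ExteriorAlgebra S E
  | 0 => 1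
  | k + 1 => ExteriorAlgebra.ι S (w k) * wedge w k

theorem wedge_eq_ιMulti {E : Type*} [AddCommGroup E] [Module S E] (w : ℕ → E) (k : ℕ) :
    wedge w k = ExteriorAlgebra.ιMulti S k fun i => w (k - 1 - i) := by
  induction k with
  | zero => simp [wedge]
  | succ k ih =>
    rw [wedge, ih, ExteriorAlgebra.ιMulti_succ_apply]
    congr 3
    ext i
    simp [Matrix.vecTail]
    congr 1
    omega

/-- An alternating map is determined by tuples of distinct basis vectors, and there are none of
length `k`. -/
theorem ιMulti_eq_zero {n k : ℕ} (hk : n < k) (v : Fin k → Fin n → S) :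
    ExteriorAlgebra.ιMulti S k v = 0 := by
  have : ExteriorAlgebra.ιMulti S k (M := Fin n → S) = 0 := by
    refine Module.Basis.ext_alternating (Pi.basisFun S (Fin n)) fun i hi => ?_
    exact absurd (Fintype.card_le_of_injective i hi) (by simpa using hk)
  rw [this, AlternatingMap.zero_apply]

/-- The Koszul differential on the exterior algebra attached to a linear form. -/
def koszul {E : Type*} [AddCommGroup E] [Module S E] (d : Module.Dual S E) :
    ExteriorAlgebra S E →ₗ[S] ExteriorAlgebra S E :=
  CliffordAlgebra.contractLeft (Q := (0 : QuadraticForm S E)) d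

variable {E : Type*} [AddCommGroup E] [Module S E] (d : Module.Dual S E)

theorem koszul_ι_mul (a : E) (b : ExteriorAlgebra S E) :
    koszul d (ExteriorAlgebra.ι S a * b) = d a • b - ExteriorAlgebra.ι S a * koszul d b :=
  CliffordAlgebra.contractLeft_ι_mul d a b

theorem koszul_koszul (b : ExteriorAlgebra S E) : koszul d (koszul d b) = 0 :=
  CliffordAlgebra.contractLeft_contractLeft d b

/-- Only the degree-one part of `b` contributes to the scalar part of its contraction, and there
contraction is `d`. -/
theorem algebraMapInv_koszul_mem (b : ExteriorAlgebra S E) :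
    ExteriorAlgebra.algebraMapInv (koszul d b) ∈ LinearMap.range d := by
  induction b using CliffordAlgebra.left_induction with
  | algebraMap r =>
    rw [show koszul d (algebraMap S _ r) = 0 from CliffordAlgebra.contractLeft_algebraMap _ d r,
      map_zero]
    exact zero_mem _
  | add x y hx hy =>
    rw [map_add, map_add]
    exact add_mem hx hy
  | ι_mul x m hx =>
    rw [show CliffordAlgebra.ι _ m * x = ExteriorAlgebra.ι S m * x from rfl, koszul_ι_mul,
      map_sub, map_mul, map_smul,
      show ExteriorAlgebra.algebraMapInv (ExteriorAlgebra.ι S m) = 0 by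
        simp [ExteriorAlgebra.algebraMapInv], zero_mul, sub_zero, smul_eq_mul, mul_comm,
      ← smul_eq_mul, ← map_smul]
    exact ⟨_, rfl⟩

theorem exists_koszul_wedge (w : ℕ → E) (k : ℕ) :
    ∃ u : ℕ → ExteriorAlgebra S E, koszul d (wedge w k) = ∑ j ∈ range k, d (w j) • u j := by
  induction k with
  | zero => exact ⟨0, CliffordAlgebra.contractLeft_one _ d⟩
  | succ k ih =>
    obtain ⟨u, hu⟩ := ih
    refine ⟨fun j => if j = k then wedge w k else -(ExteriorAlgebra.ι S (w k) * u j), ?_⟩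
    simp only [wedge, koszul_ι_mul, hu, sum_range_succ, if_pos, mul_sum]
    rw [add_comm, sub_eq_add_neg, add_right_inj, ← sum_neg_distrib]
    refine sum_congr rfl fun j hj => ?_
    rw [if_neg (mem_range.mp hj).ne, smul_neg, mul_smul_comm]

end Exterior

variable {K : Type u} {V : Type v} [Field K] [AddCommGroup V] [Module K V]

/-- If `S(V)` is free over the invariants, a functional `l` vanishing on the square of the positive
part of the invariants extends to free `S(V)`-modules: there is an additive `T` with
`T (m x) ≡ l(m) x` modulo the Hilbert ideal, for `m` in the positive part. -/
theorem exists_coordinate_map (Δ : Subgroup (LinearMap.GeneralLinearGroup K V))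
    [Module.Free (symInvariants Δ) (SymmetricAlgebra K V)]
    (l : SymmetricAlgebra K V →ₗ[K] K)
    (hl : ∀ x ∈ posPart (symInvariants Δ) * posPart (symInvariants Δ), l x = 0)
    (N : Type*) [AddCommGroup N] [Module (SymmetricAlgebra K V) N]
    [Module.Free (SymmetricAlgebra K V) N] :
    ∃ T : N →+ N, ∀ m ∈ posPart (symInvariants Δ), ∀ x : N,
      T (m • x) - algebraMap K (SymmetricAlgebra K V) (l m) • x ∈
        hilbertIdeal Δ • (⊤ : Submodule (SymmetricAlgebra K V) N) := by
  -- `T₀` applies `l` to the coordinates in an R-basis of S(V). It is not R-linear, but `l (m * r) =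
  -- ε(r) * l m` as `l` kills squares, and `r ≡ ε(r)` modulo the Hilbert ideal. `T` repeats this
  -- coordinatewise on `N`.
  let β := Module.Free.chooseBasis (symInvariants Δ) (SymmetricAlgebra K V)
  let T₀ : SymmetricAlgebra K V →+ SymmetricAlgebra K V :=
    (Finsupp.liftAddHom fun i => (AddMonoidHom.mulRight (β i)).comp
      (((algebraMap K (SymmetricAlgebra K V)).toAddMonoidHom.comp l.toAddMonoidHom).comp
        (symInvariants Δ).val.toRingHom.toAddMonoidHom)).comp β.repr.toAddEquiv.toAddMonoidHom
  have hT₀β : ∀ (r : symInvariants Δ) i, T₀ (r * β i) = algebraMap K _ (l r) * β i := by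
    intro r i
    have h : β.repr (r * β i) = Finsupp.single i r := by
      change β.repr (r • β i) = _
      rw [map_smul, β.repr_self, Finsupp.smul_single_one]
    simp [T₀, h]
  have hT₀ : ∀ m ∈ posPart (symInvariants Δ), ∀ x : SymmetricAlgebra K V,
      T₀ (m * x) - algebraMap K (SymmetricAlgebra K V) (l m) * x ∈ hilbertIdeal Δ := by
    intro m hm x
    obtain ⟨c, rfl⟩ := β.repr.symm.surjective x
    induction c using Finsupp.induction_linear with
    | zero => simp
    | add x y hx hy =>
      have := add_mem hx hy
      rw [map_add, mul_add, map_add, mul_add]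
      convert this using 1
      ring
    | single i r =>
      have h1 : β.repr.symm (Finsupp.single i r) = (r : SymmetricAlgebra K V) * β i := by
        rw [β.repr_symm_single]
        rfl
      have h2 := hT₀β (⟨m, hm.1⟩ * r) i
      have h3 : l (m * r) = SymmetricAlgebra.algebraMapInv (r : SymmetricAlgebra K V) * l m := by
        have h4 := hl _ (Submodule.mul_mem_mul hm (sub_algebraMapInv_mem_posPart r.2))
        rw [mul_sub, map_sub, sub_eq_zero, mul_comm _ (algebraMap _ _ _), ← Algebra.smul_def,
          map_smul, smul_eq_mul] at h4
        exact h4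
      rw [h1, ← mul_assoc]
      refine (congrArg (· - _ ∈ hilbertIdeal Δ) h2).mpr ?_
      have h5 := Ideal.mul_mem_left (hilbertIdeal Δ) (-algebraMap K _ (l m))
        (sub_smul_mem_hilbertIdeal r.2 (β i))
      convert h5 using 1
      change algebraMap K _ (l (m * r)) * β i - _ = _
      rw [h3, map_mul, Algebra.smul_def]
      ring
  let γ := Module.Free.chooseBasis (SymmetricAlgebra K V) N
  let T : N →+ N :=
    (Finsupp.liftAddHom fun i => ((smulAddHom (SymmetricAlgebra K V) N).flip (γ i)).comp T₀).comp
      γ.repr.toAddEquiv.toAddMonoidHom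
  have hTγ : ∀ (s : SymmetricAlgebra K V) i, T (s • γ i) = T₀ s • γ i := by
    intro s i
    simp [T]
  refine ⟨T, fun m hm x => ?_⟩
  obtain ⟨c, rfl⟩ := γ.repr.symm.surjective x
  induction c using Finsupp.induction_linear with
  | zero => simp
  | add x y hx hy =>
    have := add_mem hx hy
    rw [map_add, smul_add, map_add, smul_add]
    convert this using 1
    abel
  | single i s =>
    rw [γ.repr_symm_single, smul_smul, smul_smul, hTγ, ← sub_smul]
    exact Submodule.smul_mem_smul (hT₀ m hm s) trivial

theorem augIdeal_eq_range_linearCombination {ι : Type*} [Fintype ι] (b : Module.Basis ι K V) :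
    augIdeal K V = LinearMap.range (Fintype.linearCombination (SymmetricAlgebra K V)
      fun i => SymmetricAlgebra.ι K V (b i)) := by
  rw [Fintype.range_linearCombination]
  apply le_antisymm
  · intro x hx
    have key : ∀ x : SymmetricAlgebra K V, x - algebraMap K _ (SymmetricAlgebra.algebraMapInv x) ∈
        Ideal.span (Set.range fun i => SymmetricAlgebra.ι K V (b i)) := by
      intro x
      induction x using SymmetricAlgebra.induction with
      | algebraMap r => simp
      | ι v =>
        rw [SymmetricAlgebra.algebraMapInv_ι, map_zero, sub_zero, ← b.sum_repr v, map_sum]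
        refine sum_mem fun i _ => ?_
        rw [map_smul]
        exact Submodule.smul_of_tower_mem _ _ (Ideal.subset_span ⟨i, rfl⟩)
      | mul x y hx hy =>
        have := add_mem (Ideal.mul_mem_left _ x hy)
          (Ideal.mul_mem_right (algebraMap K _ (SymmetricAlgebra.algebraMapInv y)) _ hx)
        convert this using 1
        rw [map_mul, map_mul]
        ring
      | add x y hx hy =>
        have := add_mem hx hy
        convert this using 1
        rw [map_add, map_add]
        ring
    have := key x
    rwa [mem_augIdeal.mp hx, map_zero, sub_zero] at this
  · refine Ideal.span_le.mpr ?_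
    rintro _ ⟨i, rfl⟩
    exact SymmetricAlgebra.algebraMapInv_ι _

/-- If `S(V)` is free over the invariants, there are at most `dim V` elements of the positive part
of the invariants that are linearly independent modulo squares. -/
theorem card_le_finrank_of_free [FiniteDimensional K V]
    (Δ : Subgroup (LinearMap.GeneralLinearGroup K V))
    [Module.Free (symInvariants Δ) (SymmetricAlgebra K V)]
    {m : ℕ} (f : Fin m → SymmetricAlgebra K V) (hf : ∀ i, f i ∈ posPart (symInvariants Δ))
    (hli : LinearIndependent K fun i =>
      (posPart (symInvariants Δ) * posPart (symInvariants Δ)).mkQ (f i)) :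
    m ≤ Module.finrank K V := by
  let b := Module.finBasis K V
  let E := Fin (Module.finrank K V) → SymmetricAlgebra K V
  let d : Module.Dual (SymmetricAlgebra K V) E :=
    Fintype.linearCombination (SymmetricAlgebra K V) fun i => SymmetricAlgebra.ι K V (b i)
  have hd : augIdeal K V = LinearMap.range d := augIdeal_eq_range_linearCombination b
  have hw : ∀ i : ℕ, ∃ w : E, ∀ h : i < m, d w = f ⟨i, h⟩ := by
    intro i
    by_cases h : i < m
    · have := (hf ⟨i, h⟩).2
      rw [Submodule.coe_restrictScalars, hd] at this
      obtain ⟨w, hw⟩ := this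
      exact ⟨w, fun _ => hw⟩
    · exact ⟨0, fun h' => absurd h' h⟩
  choose w hw using hw
  -- The wedge products of the lifts `w i` of `f i` stay nonzero modulo boundaries and the Hilbert
  -- ideal. For `k = 0` the scalar part decides. If `wedge w (k + 1)` is a boundary plus `z`,
  -- applying `koszul d` and then the operator `T` that extracts the coefficient of `f k` puts
  -- `wedge w k` in the same submodule.
  have key : ∀ k ≤ m, wedge w k ∉ LinearMap.range (koszul d) ⊔
      hilbertIdeal Δ • (⊤ : Submodule (SymmetricAlgebra K V)
        (ExteriorAlgebra (SymmetricAlgebra K V) E)) := by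
    intro k
    induction k with
    | zero =>
      intro _ h
      have h1 : ∀ x ∈ LinearMap.range (koszul d) ⊔
          hilbertIdeal Δ • (⊤ : Submodule (SymmetricAlgebra K V)
          (ExteriorAlgebra (SymmetricAlgebra K V) E)),
          ExteriorAlgebra.algebraMapInv x ∈ augIdeal K V := by
        intro x hx
        obtain ⟨_, ⟨y, rfl⟩, z, hz, rfl⟩ := Submodule.mem_sup.mp hx
        rw [map_add]
        refine add_mem ?_ ?_
        · rw [hd]
          exact algebraMapInv_koszul_mem d y
        · refine Submodule.smul_induction_on hz ?_ ?_
          · intro r hr n _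
            rw [map_smul]
            exact Ideal.mul_mem_right _ _ (hilbertIdeal_le Δ hr)
          · intro x y hx hy
            rw [map_add]
            exact add_mem hx hy
      have h2 := h1 _ h
      rw [wedge, map_one, mem_augIdeal, map_one] at h2
      exact one_ne_zero h2
    | succ k ih =>
      intro hk h
      apply ih (by omega)
      obtain ⟨π, hπ⟩ := LinearMap.exists_leftInverse_of_injective _
        (LinearMap.ker_eq_bot.mpr hli)
      let l : SymmetricAlgebra K V →ₗ[K] K := Finsupp.lapply (⟨k, hk⟩ : Fin m) ∘ₗ π ∘ₗ
        (posPart (symInvariants Δ) * posPart (symInvariants Δ)).mkQ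
      have hl : ∀ x ∈ posPart (symInvariants Δ) * posPart (symInvariants Δ), l x = 0 := by
        intro x hx
        have : (posPart (symInvariants Δ) * posPart (symInvariants Δ)).mkQ x = 0 :=
          (Submodule.Quotient.mk_eq_zero _).mpr hx
        simp only [l, LinearMap.comp_apply, this, map_zero]
      have hlf : ∀ i, l (f i) = if i = ⟨k, hk⟩ then 1 else 0 := by
        intro i
        have := LinearMap.congr_fun hπ (Finsupp.single i 1)
        simp only [LinearMap.comp_apply, Finsupp.linearCombination_single, one_smul,
          LinearMap.id_apply] at this
        simp only [l, LinearMap.comp_apply, this, Finsupp.lapply_apply, Finsupp.single_apply]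
      obtain ⟨T, hT⟩ := exists_coordinate_map Δ l hl
        (ExteriorAlgebra (SymmetricAlgebra K V) E)
      set J := LinearMap.range (koszul d) ⊔ hilbertIdeal Δ •
        (⊤ : Submodule (SymmetricAlgebra K V) (ExteriorAlgebra (SymmetricAlgebra K V) E)) with hJ
      obtain ⟨_, ⟨y, rfl⟩, z, hz, hyz⟩ := Submodule.mem_sup.mp h
      -- For `r` in the positive part, `T (r • koszul d n)` is `l r • koszul d n` up to the Hilbert
      -- ideal, hence a boundary up to it. As `T` is only additive, other coefficients are first
      -- absorbed into `n`.
      have h1 : T (koszul d z) ∈ J := by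
        refine Submodule.smul_induction_on hz ?_ ?_
        · intro r hr n _
          rw [map_smul]
          induction hr using Submodule.span_induction generalizing n with
          | mem r hr =>
            have h2 := hT r hr (koszul d n)
            rw [← sub_add_cancel (T _) (algebraMap K (SymmetricAlgebra K V) (l r) • koszul d n)]
            exact add_mem (Submodule.mem_sup_right h2)
              (Submodule.smul_mem _ _ (Submodule.mem_sup_left ⟨n, rfl⟩))
          | zero => simp
          | add r s _ _ hr hs =>
            rw [add_smul, map_add]
            exact add_mem (hr n trivial) (hs n trivial)
          | smul a r _ hr =>
            have := hr (a • n) trivial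
            rwa [(koszul d).map_smul, smul_smul, mul_comm] at this
        · intro x y hx hy
          rw [map_add, map_add]
          exact add_mem hx hy
      have h2 : koszul d z = koszul d (wedge w (k + 1)) := by
        rw [← hyz, map_add, koszul_koszul, zero_add]
      -- By the Leibniz rule all remaining terms carry a coefficient `d (w j) = f j` with `j < k`,
      -- on which `l` vanishes; only `f k • wedge w k` survives `T`.
      obtain ⟨u, hu⟩ := exists_koszul_wedge d w k
      rw [h2, wedge, koszul_ι_mul, hu, mul_sum, map_sub, map_sum] at h1
      have h3 : T (d (w k) • wedge w k) - wedge w k ∈ J := by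
        have := hT _ (hf ⟨k, hk⟩) (wedge w k)
        rw [hlf, if_pos rfl, map_one, one_smul] at this
        rw [hw k hk]
        exact Submodule.mem_sup_right this
      have h4 : ∑ j ∈ range k, T (ExteriorAlgebra.ι (SymmetricAlgebra K V) (w k) *
          d (w j) • u j) ∈ J := by
        refine sum_mem fun j hj => ?_
        have hj' := mem_range.mp hj
        have := hT _ (hf ⟨j, by omega⟩)
          (ExteriorAlgebra.ι (SymmetricAlgebra K V) (w k) * u j)
        rw [hlf, if_neg (by simpa using hj'.ne), map_zero, zero_smul, sub_zero] at this
        rw [mul_smul_comm, hw j (by omega)]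
        exact Submodule.mem_sup_right this
      have h5 := sub_mem (add_mem h1 h4) h3
      rwa [sub_add_cancel, sub_sub_cancel] at h5
  by_contra hlt
  refine key m le_rfl ?_
  rw [wedge_eq_ιMulti, ιMulti_eq_zero (not_le.mp hlt)]
  exact zero_mem _

end CST

end

/-! ### Orbit polynomials, homogeneous generators and polynomiality. -/

noncomputable section

namespace CST

open Polynomial Finset

section Orbit

variable {K : Type*} {A : Type*} [Field K] [CommRing A] [Algebra K A] {G : Type*} [Group G]
  (φ : G →* (A →ₐ[K] A)) (Δ : Subgroup G)

theorem action_injective (g : G) : Function.Injective (φ g) := by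
  refine Function.LeftInverse.injective (g := φ g⁻¹) fun x => ?_
  rw [← AlgHom.mul_apply, ← map_mul, inv_mul_cancel, map_one, AlgHom.one_apply]

/-- The orbit of an element under a finite group of algebra endomorphisms. -/
def orbitFinset [Fintype Δ] (x : A) : Finset A :=
  open scoped Classical in univ.image fun g : Δ => φ g x

variable {φ Δ}

theorem mem_orbitFinset [Fintype Δ] {x y : A} : y ∈ orbitFinset φ Δ x ↔ ∃ g ∈ Δ, φ g x = y := by
  simp [orbitFinset]

theorem self_mem_orbitFinset [Fintype Δ] (x : A) : x ∈ orbitFinset φ Δ x :=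
  mem_orbitFinset.mpr ⟨1, Δ.one_mem, by rw [map_one, AlgHom.one_apply]⟩

/-- The polynomial whose roots are the points of an orbit has invariant coefficients. -/
theorem exists_map_eq_prod_orbit [Fintype Δ] (x : A) :
    ∃ q : (invariants φ Δ)[X], q.Monic ∧
      q.map (algebraMap (invariants φ Δ) A) = ∏ c ∈ orbitFinset φ Δ x, (X - C c) := by
  classical
  set p : A[X] := ∏ c ∈ orbitFinset φ Δ x, (X - C c) with hp
  have hmonic : p.Monic := monic_prod_of_monic _ _ fun c _ => monic_X_sub_C c
  have hinv : ∀ g ∈ Δ, p.map (φ g : A →+* A) = p := by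
    intro g hg
    have himage : (orbitFinset φ Δ x).image (φ g) = orbitFinset φ Δ x := by
      refine eq_of_subset_of_card_le ?_ (card_image_of_injective _ (action_injective φ g)).ge
      intro c hc
      obtain ⟨d, hd, rfl⟩ := mem_image.mp hc
      obtain ⟨h, hh, rfl⟩ := mem_orbitFinset.mp hd
      refine mem_orbitFinset.mpr ⟨g * h, Δ.mul_mem hg hh, ?_⟩
      rw [map_mul, AlgHom.mul_apply]
    rw [hp, Polynomial.map_prod]
    conv_rhs => rw [← himage, prod_image fun a _ b _ h => action_injective φ g h]
    exact prod_congr rfl fun c _ => by simp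
  have hlift : p ∈ lifts (algebraMap (invariants φ Δ) A) := by
    rw [lifts_iff_coeff_lifts]
    intro k
    refine ⟨⟨p.coeff k, fun g hg => ?_⟩, rfl⟩
    conv_rhs => rw [← hinv g hg]
    rw [coeff_map]
    rfl
  obtain ⟨q, hq, -, hqm⟩ := lifts_and_natDegree_eq_and_monic hlift hmonic
  exact ⟨q, hqm, hq⟩

theorem isIntegral_invariants [Finite Δ] : Algebra.IsIntegral (invariants φ Δ) A := by
  have := Fintype.ofFinite Δ
  refine ⟨fun x => ?_⟩
  obtain ⟨q, hq, h⟩ := exists_map_eq_prod_orbit (φ := φ) (Δ := Δ) x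
  refine ⟨q, hq, ?_⟩
  rw [eval₂_eq_eval_map, h, eval_prod]
  exact prod_eq_zero (self_mem_orbitFinset x) (by simp)

end Orbit

variable {K : Type u} {V : Type v} [Field K] [AddCommGroup V] [Module K V]

/-- There are at most `n` elements of the positive part of `B` that are linearly independent
modulo squares. -/
def CotangentRankLE (B : Subalgebra K (SymmetricAlgebra K V)) (n : ℕ) : Prop :=
  ∀ (m : ℕ) (f : Fin m → SymmetricAlgebra K V), (∀ i, f i ∈ posPart B) →
    LinearIndependent K (fun i => (posPart B * posPart B).mkQ (f i)) → m ≤ n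

/-- Classes of homogeneous elements span the positive part modulo squares, so a basis of that
quotient can be chosen among them; the rank bound makes it finite, and its lifts generate. -/
theorem exists_homogeneous_generators {B : Subalgebra K (SymmetricAlgebra K V)} (hB : IsGraded B)
    {n : ℕ} (h : CotangentRankLE B n) :
    ∃ e ≤ n, ∃ f : Fin e → SymmetricAlgebra K V, (∀ i, f i ∈ posPart B) ∧
      (∀ i, ∃ d, gr (f i) = monomial d (f i)) ∧ Algebra.adjoin K (Set.range f) = B := by
  set q := (posPart B * posPart B).mkQ with hq
  obtain ⟨b, hb, hspan, hli⟩ := exists_linearIndependent K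
    (q '' {x | x ∈ posPart B ∧ ∃ d, gr x = monomial d x})
  have hb' : ∀ a ∈ b, ∃ x, (x ∈ posPart B ∧ ∃ d, gr x = monomial d x) ∧ q x = a :=
    fun a ha => hb ha
  choose! y hy using hb'
  have hcard : ∀ t : Finset b, t.card ≤ n := by
    intro t
    let e := t.equivFin.symm
    refine h t.card (fun i => y (e i).1) (fun i => (hy _ (e i).1.2).1.1) ?_
    have : (fun i => q (y (e i).1)) = fun i => ((e i).1 : _ ⧸ posPart B * posPart B) :=
      funext fun i => (hy _ (e i).1.2).2
    rw [← hq, this]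
    exact hli.comp (fun i => (e i).1) (Subtype.val_injective.comp e.injective)
  have : Finite b := by
    refine not_infinite_iff_finite.mp fun hinf => ?_
    obtain ⟨t, ht⟩ := Infinite.exists_subset_card_eq b (n + 1)
    have := hcard t
    omega
  have := Fintype.ofFinite b
  let e := (Fintype.equivFin b).symm
  refine ⟨Fintype.card b, hcard univ, fun i => y (e i), fun i => (hy _ (e i).2).1.1,
    fun i => (hy _ (e i).2).1.2, ?_⟩
  refine adjoin_eq_of_posPart_le hB _ (fun i => (hy _ (e i).2).1.1.1)
    (fun i => (hy _ (e i).2).1.2) ?_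
  intro x hx
  have hx' : q x ∈ Submodule.span K b := by
    rw [hspan, ← sum_component x, map_sum]
    exact sum_mem fun d _ => Submodule.subset_span ⟨component d x,
      ⟨⟨hB x hx.1 d, component_mem_augIdeal' hx.2 d⟩, d, gr_component d x⟩, rfl⟩
  have hbr : b = q '' Set.range fun i => y (e i) := by
    rw [← Set.range_comp]
    ext a
    constructor
    · intro ha
      exact ⟨e.symm ⟨a, ha⟩, by simp [(hy a ha).2]⟩
    · rintro ⟨i, rfl⟩
      simp only [Function.comp_apply, (hy _ (e i).2).2]
      exact (e i).2
  rw [hbr, Submodule.span_image] at hx'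
  have := Submodule.mem_comap.mpr hx'
  rw [Submodule.comap_map_mkQ] at this
  rwa [sup_comm] at this

theorem lift_trdeg_symmetricAlgebra [FiniteDimensional K V] :
    Algebra.trdeg K (SymmetricAlgebra K V) = Module.finrank K V := by
  have h := (SymmetricAlgebra.equivMvPolynomial (Module.finBasis K V)).lift_trdeg_eq
  rw [MvPolynomial.trdeg_of_isDomain] at h
  simpa using h

theorem isAlgebraic_symInvariants (Δ : Subgroup (LinearMap.GeneralLinearGroup K V)) [Finite Δ] :
    Algebra.IsAlgebraic (symInvariants Δ) (SymmetricAlgebra K V) :=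
  have := isIntegral_invariants (φ := symAction K V) (Δ := Δ)
  Algebra.IsIntegral.isAlgebraic

/-- If the cotangent space of the invariants has dimension at most `dim V`, the invariants are
freely generated by `dim V` homogeneous elements. -/
theorem exists_polynomial_generators [FiniteDimensional K V]
    (Δ : Subgroup (LinearMap.GeneralLinearGroup K V)) [Finite Δ]
    (h : CotangentRankLE (symInvariants Δ) (Module.finrank K V)) :
    ∃ f : Fin (Module.finrank K V) → SymmetricAlgebra K V,
      (∀ i, f i ∈ posPart (symInvariants Δ)) ∧ (∀ i, ∃ d, gr (f i) = monomial d (f i)) ∧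
      Algebra.adjoin K (Set.range f) = symInvariants Δ ∧ AlgebraicIndependent K f := by
  obtain ⟨e, he, f, hf, hom, hadj⟩ := exists_homogeneous_generators (isGraded_symInvariants Δ) h
  have halg : Algebra.IsAlgebraic (Algebra.adjoin K (Set.range f)) (SymmetricAlgebra K V) := by
    rw [hadj]
    exact isAlgebraic_symInvariants Δ
  -- S(V) is algebraic over the algebra generated by the `f i`, so their number is at least the
  -- transcendence degree; equality makes them a transcendence basis.
  have hge : Module.finrank K V ≤ e := by
    have h1 := Algebra.IsAlgebraic.trdeg_le_cardinalMk K (Set.range f)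
    rw [lift_trdeg_symmetricAlgebra] at h1
    have := Fintype.ofFinite (Set.range f)
    rw [Cardinal.mk_fintype, Nat.cast_le] at h1
    exact h1.trans ((Fintype.card_le_of_surjective _ Set.rangeFactorization_surjective).trans_eq
      (Fintype.card_fin e))
  obtain rfl : e = Module.finrank K V := le_antisymm he hge
  refine ⟨f, hf, hom, hadj, ?_⟩
  refine (Algebra.IsAlgebraic.isTranscendenceBasis_of_lift_le_trdeg_of_finite K f ?_).1
  rw [lift_trdeg_symmetricAlgebra]
  simp

theorem isPolynomialAlgebra_of_cotangentRankLE [FiniteDimensional K V]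
    (Δ : Subgroup (LinearMap.GeneralLinearGroup K V)) [Finite Δ]
    (h : CotangentRankLE (symInvariants Δ) (Module.finrank K V)) :
    IsPolynomialAlgebra K (symInvariants Δ) := by
  obtain ⟨f, -, -, hadj, hind⟩ := exists_polynomial_generators Δ h
  exact ⟨_, ⟨hind.aevalEquiv.trans (Subalgebra.equivOfEq _ _ hadj)⟩⟩

end CST

end

/-! ### Conjugacy of homomorphisms and the Jacobian criterion. -/

noncomputable section

namespace CST

open Polynomial Finset

section OrbitHom

variable {K : Type*} {A : Type*} [Field K] [CommRing A] [Algebra K A] {G : Type*} [Group G]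

/-- The action on `A[X]` through the coefficients. -/
def polyAction (φ : G →* (A →ₐ[K] A)) : G →* (A[X] →ₐ[K] A[X]) where
  toFun g := mapAlgHom (φ g)
  map_one' := by
    ext <;> simp
  map_mul' g h := by
    ext <;> simp

theorem polyAction_apply (φ : G →* (A →ₐ[K] A)) (g : G) (p : A[X]) :
    polyAction φ g p = p.map (φ g : A →+* A) := rfl

theorem map_eval_map {R B B' : Type*} [CommRing R] [CommRing B] [CommRing B'] (i : R →+* B)
    (θ : B →+* B') (p : R[X][X]) (b : B[X]) :
    ((p.map (mapRingHom i)).eval b).map θ =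
      (p.map (mapRingHom (θ.comp i))).eval (b.map θ) := by
  rw [← mapRingHom_comp, ← Polynomial.map_map, ← coe_mapRingHom]
  exact (eval_map_apply _ _).symm

variable (φ : G →* (A →ₐ[K] A)) (Δ : Subgroup G) [Fintype Δ]

theorem exists_map_map_eq_prod_orbit (x : A[X]) :
    ∃ q : (invariants φ Δ)[X][X], q.map (mapRingHom (algebraMap (invariants φ Δ) A)) =
      ∏ c ∈ orbitFinset (polyAction φ) Δ x, (X - C c) := by
  obtain ⟨q, -, hq⟩ := exists_map_eq_prod_orbit (φ := polyAction φ) (Δ := Δ) x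
  rw [← hq]
  refine (mem_lifts _).mp ((lifts_iff_coeff_lifts _).mpr fun k => ?_)
  rw [coeff_map]
  refine (mem_lifts _).mp ((lifts_iff_coeff_lifts _).mpr fun m => ?_)
  refine ⟨⟨((q.coeff k : A[X])).coeff m, fun g hg => ?_⟩, rfl⟩
  have := (q.coeff k).2 g hg
  rw [polyAction_apply] at this
  conv_rhs => rw [← this]
  rw [coeff_map]
  rfl

/-- Two homomorphisms which agree on the invariants of a finite group agree up to the group, in the
sense that a product over an orbit vanishes. -/
theorem prod_orbit_sub_eq_zero {B Ω : Type*} [CommRing B] [CommRing Ω] {j : B →+* A}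
    (hj : Function.Injective j) (i : invariants φ Δ →+* B) (hij : ∀ r, j (i r) = r)
    (φ₀ : A →+* Ω) (ψ : B →+* Ω) (hψ : ∀ r, ψ (i r) = φ₀ r) (b : B[X]) :
    ∏ c ∈ orbitFinset (polyAction φ) Δ (b.map j), (b.map ψ - c.map φ₀) = 0 := by
  obtain ⟨p, hp⟩ := exists_map_map_eq_prod_orbit φ Δ (b.map j)
  -- The orbit polynomial of `b.map j` has invariant coefficients, so by injectivity of `j` it
  -- already kills `b` over `B`. Applying `ψ` turns its coefficients into their images under `φ₀`.
  have h0 : (p.map (mapRingHom i)).eval b = 0 := by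
    refine map_injective j hj ?_
    have h1 : j.comp i = algebraMap (invariants φ Δ) A := RingHom.ext hij
    rw [map_eval_map, h1, hp, Polynomial.map_zero, eval_prod]
    exact prod_eq_zero (self_mem_orbitFinset _) (by simp)
  have h2 : ψ.comp i = φ₀.comp (algebraMap (invariants φ Δ) A) := RingHom.ext hψ
  have h3 := map_eval_map i ψ p b
  rw [h0, Polynomial.map_zero, h2, ← mapRingHom_comp, ← Polynomial.map_map, hp,
    Polynomial.map_prod, eval_prod] at h3
  rw [h3]
  exact prod_congr rfl fun c _ => by simp

end OrbitHom

section CoeffPoly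

variable {A : Type*} [CommRing A] {n : ℕ}

/-- The polynomial with given coefficients. -/
def coeffPoly (x : Fin n → A) : A[X] := ∑ i : Fin n, monomial i (x i)

theorem coeff_coeffPoly (x : Fin n → A) (i : Fin n) : (coeffPoly x).coeff i = x i := by
  rw [coeffPoly, finsetSum_coeff, sum_eq_single i]
  · simp
  · intro j _ hj
    rw [coeff_monomial, if_neg fun h => hj (Fin.ext h)]
  · simp

theorem coeffPoly_injective : Function.Injective (coeffPoly : (Fin n → A) → A[X]) := by
  intro x y h
  ext i
  rw [← coeff_coeffPoly x, h, coeff_coeffPoly]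

theorem map_coeffPoly {B : Type*} [CommRing B] (f : A →+* B) (x : Fin n → A) :
    (coeffPoly x).map f = coeffPoly fun i => f (x i) := by
  simp [coeffPoly, Polynomial.map_sum]

theorem coeffPoly_sub (x y : Fin n → A) : coeffPoly x - coeffPoly y = coeffPoly (x - y) := by
  simp [coeffPoly, sum_sub_distrib]

end CoeffPoly

section DualNumber

variable {K L : Type*} [Field K] [Field L] [Algebra K L]

/-- First-order Taylor expansion: a vector in the kernel of a Jacobian matrix becomes a tangent
deformation leaving the polynomials unchanged. -/
theorem aeval_dualNumber {n : ℕ} (a v : Fin n → L) (F : MvPolynomial (Fin n) K) :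
    MvPolynomial.aeval (fun j => (TrivSqZeroExt.inl (a j) + TrivSqZeroExt.inr (v j) :
      TrivSqZeroExt L L)) F = TrivSqZeroExt.inl (MvPolynomial.aeval a F) +
        TrivSqZeroExt.inr (∑ j, MvPolynomial.aeval a (MvPolynomial.pderiv j F) * v j) := by
  induction F using MvPolynomial.induction_on with
  | C r =>
    simp only [← MvPolynomial.algebraMap_eq, AlgHom.commutes, Derivation.map_algebraMap, map_zero,
      zero_mul, sum_const_zero, TrivSqZeroExt.inr_zero, add_zero]
    rfl
  | add p q hp hq =>
    simp only [map_add, hp, hq, add_mul, sum_add_distrib, TrivSqZeroExt.inl_add,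
      TrivSqZeroExt.inr_add]
    abel
  | mul_X p i hp =>
    have h1 : ∑ j, MvPolynomial.aeval a (MvPolynomial.pderiv j (p * MvPolynomial.X i)) * v j =
        MvPolynomial.aeval a p * v i +
          a i * ∑ j, MvPolynomial.aeval a (MvPolynomial.pderiv j p) * v j := by
      simp only [MvPolynomial.pderiv_mul, MvPolynomial.pderiv_X, map_add, map_mul, add_mul,
        sum_add_distrib, MvPolynomial.aeval_X]
      rw [add_comm, mul_sum]
      congr 1
      · rw [sum_eq_single i]
        · simp
        · intro j _ hj
          simp [hj.symm]
        · simp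
      · exact sum_congr rfl fun j _ => by ring
    rw [map_mul, map_mul, hp, MvPolynomial.aeval_X, MvPolynomial.aeval_X, h1]
    ext
    · simp
    · simp
      ring

theorem mul_map_fst_eq_zero {n : ℕ} (v : Fin n → L) (Q : (TrivSqZeroExt L L)[X])
    (h : coeffPoly (fun i => (TrivSqZeroExt.inr (v i) : TrivSqZeroExt L L)) * Q = 0) :
    coeffPoly v * Q.map (TrivSqZeroExt.fstHom L L L : TrivSqZeroExt L L →+* L) = 0 := by
  have h1 : ∀ k, (coeffPoly fun i => (TrivSqZeroExt.inr (v i) : TrivSqZeroExt L L)).coeff k =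
      TrivSqZeroExt.inr ((coeffPoly v).coeff k) := by
    intro k
    simp only [coeffPoly, finsetSum_coeff, coeff_monomial]
    rw [← TrivSqZeroExt.inrHom_apply L L (∑ i, _), map_sum]
    refine sum_congr rfl fun i _ => ?_
    split_ifs <;> simp
  ext k
  have h2 := congrArg TrivSqZeroExt.snd (congrArg (fun p => p.coeff k) h)
  simp only [coeff_mul, h1, coeff_zero, TrivSqZeroExt.snd_zero] at h2
  rw [coeff_zero, ← h2, coeff_mul, ← TrivSqZeroExt.sndHom_apply L L (∑ i ∈ _, _), map_sum]
  refine sum_congr rfl fun i _ => ?_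
  simp

end DualNumber

variable {K : Type u} {V : Type v} [Field K] [AddCommGroup V] [Module K V]

instance symmetricAlgebra_uniqueFactorizationMonoid [FiniteDimensional K V] :
    UniqueFactorizationMonoid (SymmetricAlgebra K V) :=
  (SymmetricAlgebra.equivMvPolynomial (Module.finBasis K V)).symm.toMulEquiv.uniqueFactorizationMonoid
    inferInstance

/-- Homomorphisms from `S(V)` to a domain which agree on the invariants of a finite group are
conjugate under the group. -/
theorem exists_comp_symAction_eq [FiniteDimensional K V]
    (H : Subgroup (LinearMap.GeneralLinearGroup K V)) [Finite H] {Ω : Type*} [CommRing Ω]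
    [IsDomain Ω] [Algebra K Ω] (φ₀ ψ : SymmetricAlgebra K V →ₐ[K] Ω)
    (h : ∀ r ∈ symInvariants H, ψ r = φ₀ r) : ∃ g ∈ H, ψ = φ₀.comp (symAction K V g) := by
  have := Fintype.ofFinite H
  let b := Module.finBasis K V
  have h0 := prod_orbit_sub_eq_zero (symAction K V) H (j := RingHom.id _) Function.injective_id
    (algebraMap (symInvariants H) _) (fun r => rfl) (φ₀ : SymmetricAlgebra K V →+* Ω)
    (ψ : SymmetricAlgebra K V →+* Ω) (fun r => h r r.2)
    (coeffPoly fun i => SymmetricAlgebra.ι K V (b i))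
  -- Packing all basis vectors into the coefficients of one polynomial makes a single vanishing
  -- factor yield one group element that works for every coordinate.
  obtain ⟨c, hc, hc0⟩ := prod_eq_zero_iff.mp h0
  obtain ⟨g, hg, rfl⟩ := mem_orbitFinset.mp hc
  refine ⟨g, hg, ?_⟩
  apply SymmetricAlgebra.algHom_ext
  refine b.ext fun i => ?_
  rw [polyAction_apply, Polynomial.map_id, map_coeffPoly, map_coeffPoly, map_coeffPoly,
    sub_eq_zero] at hc0
  exact congrFun (coeffPoly_injective hc0) i

/-- If the invariants of `Δ` and of a subgroup `H` are polynomial algebras, the Jacobian matrix of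
the generators is injective at each prime at which no element of `Δ` outside `H` is inert. -/
theorem jacobian_injective [FiniteDimensional K V]
    (Δ H : Subgroup (LinearMap.GeneralLinearGroup K V)) [Finite Δ] [Finite H] (hH : H ≤ Δ) {n : ℕ}
    {h f : Fin n → SymmetricAlgebra K V} (hind : AlgebraicIndependent K h)
    (hh : Algebra.adjoin K (Set.range h) = symInvariants H)
    (hf : Algebra.adjoin K (Set.range f) = symInvariants Δ)
    {F : Fin n → MvPolynomial (Fin n) K} (hF : ∀ i, MvPolynomial.aeval h (F i) = f i)
    {L : Type*} [Field L] [Algebra K L] (φ₀ : SymmetricAlgebra K V →ₐ[K] L)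
    (hp : ∀ g ∈ Δ, ∀ k ∈ H, (∀ s, φ₀ (symAction K V g s) = φ₀ (symAction K V k s)) → g ∈ H)
    (v : Fin n → L)
    (hv : ∀ i, ∑ j, φ₀ (MvPolynomial.aeval h (MvPolynomial.pderiv j (F i))) * v j = 0) :
    v = 0 := by
  classical
  have := Fintype.ofFinite Δ
  have hle : symInvariants Δ ≤ Algebra.adjoin K (Set.range h) := by
    rw [hh]
    exact fun x hx g hg => hx g (hH hg)
  let i : symInvariants Δ →ₐ[K] MvPolynomial (Fin n) K :=
    hind.aevalEquiv.symm.toAlgHom.comp (Subalgebra.inclusion hle)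
  have hij : ∀ r, MvPolynomial.aeval h (i r) = r := by
    intro r
    have := hind.algebraMap_aevalEquiv (i r)
    rw [← this]
    simp [i]
  have hinj : Function.Injective (MvPolynomial.aeval (R := K) h) := hind
  -- `ψ` deforms `φ₀` on the invariants of `H` in the direction `v`; the hypothesis `hv` says that
  -- the deformation is trivial on the invariants of `Δ`.
  let ψ : MvPolynomial (Fin n) K →ₐ[K] TrivSqZeroExt L L := MvPolynomial.aeval fun j =>
    TrivSqZeroExt.inl (φ₀ (h j)) + TrivSqZeroExt.inr (v j)
  let φ₁ : SymmetricAlgebra K V →ₐ[K] TrivSqZeroExt L L :=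
    (TrivSqZeroExt.inlAlgHom K L L).comp φ₀
  have hψF : ∀ k, ψ (F k) = φ₁ (f k) := by
    intro k
    have h1 : ∀ P : MvPolynomial (Fin n) K,
        MvPolynomial.aeval (fun j => φ₀ (h j)) P = φ₀ (MvPolynomial.aeval h P) := fun P =>
      (MvPolynomial.comp_aeval_apply _ φ₀ P).symm
    simp only [ψ, aeval_dualNumber, h1, hv, hF, TrivSqZeroExt.inr_zero, add_zero]
    rfl
  have hψ : ∀ r, ψ (i r) = φ₁ r := by
    intro r
    have hr : (r : SymmetricAlgebra K V) ∈ Algebra.adjoin K (Set.range f) := by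
      rw [hf]
      exact r.2
    rw [Algebra.adjoin_range_eq_range_aeval] at hr
    obtain ⟨P, hP⟩ := hr
    have hP' : MvPolynomial.aeval f P = (r : SymmetricAlgebra K V) := hP
    have h1 : i r = MvPolynomial.aeval F P := by
      apply hinj
      rw [hij, ← hP', MvPolynomial.comp_aeval_apply]
      simp only [hF]
    rw [h1, MvPolynomial.comp_aeval_apply, ← hP', MvPolynomial.comp_aeval_apply]
    simp only [hψF]
  have h0 := prod_orbit_sub_eq_zero (symAction K V) Δ
    (j := (MvPolynomial.aeval h : MvPolynomial (Fin n) K →ₐ[K] _).toRingHom) hinj i.toRingHom hij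
    φ₁.toRingHom ψ.toRingHom hψ (coeffPoly MvPolynomial.X)
  have hmap : (coeffPoly MvPolynomial.X).map
      (MvPolynomial.aeval h : MvPolynomial (Fin n) K →ₐ[K] _).toRingHom = coeffPoly h := by
    rw [map_coeffPoly]
    simp
  have hmapψ : (coeffPoly MvPolynomial.X).map ψ.toRingHom =
      coeffPoly fun j => TrivSqZeroExt.inl (φ₀ (h j)) + TrivSqZeroExt.inr (v j) := by
    rw [map_coeffPoly]
    simp [ψ]
  -- The factor of the identity is the infinitesimal `v`, so only the reduction of the other factors
  -- matters. If one of them vanishes, `φ₀` and its composite with `g` agree on the invariants of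
  -- `H`, so they are conjugate under `H` and `hp` forces `g ∈ H`. But then `g` fixes `h`, and that
  -- factor had been erased.
  rw [hmap, hmapψ, ← mul_prod_erase _ _ (self_mem_orbitFinset _), map_coeffPoly, coeffPoly_sub]
    at h0
  have h1 : ((fun j => TrivSqZeroExt.inl (φ₀ (h j)) + TrivSqZeroExt.inr (v j)) -
      fun j => φ₁.toRingHom (h j)) = fun j => (TrivSqZeroExt.inr (v j) : TrivSqZeroExt L L) := by
    ext j <;> simp [φ₁]
  rw [h1] at h0
  have h2 := mul_map_fst_eq_zero v _ h0
  rw [mul_eq_zero] at h2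
  rcases h2 with h2 | h2
  · refine coeffPoly_injective (h2.trans ?_)
    simp [coeffPoly]
  · exfalso
    rw [Polynomial.map_prod, prod_eq_zero_iff] at h2
    obtain ⟨c, hc, hc0⟩ := h2
    obtain ⟨hne, hc⟩ := mem_erase.mp hc
    obtain ⟨g, hg, rfl⟩ := mem_orbitFinset.mp hc
    rw [polyAction_apply, map_coeffPoly] at hne
    rw [polyAction_apply, map_coeffPoly, map_coeffPoly, coeffPoly_sub, map_coeffPoly] at hc0
    have h3 : ∀ j, φ₀ (h j) = φ₀ (symAction K V g (h j)) := by
      intro j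
      have h4 : coeffPoly (0 : Fin n → L) = 0 := by simp [coeffPoly]
      have h5 := congrFun (coeffPoly_injective (hc0.trans h4.symm)) j
      simp [φ₁] at h5
      exact sub_eq_zero.mp h5
    have h6 : ∀ r ∈ symInvariants H, (φ₀.comp (symAction K V g)) r = φ₀ r := by
      intro r hr
      rw [← hh, Algebra.adjoin_range_eq_range_aeval] at hr
      obtain ⟨P, rfl⟩ := hr
      change φ₀.comp (symAction K V g) (MvPolynomial.aeval h P) = φ₀ (MvPolynomial.aeval h P)
      rw [MvPolynomial.comp_aeval_apply, MvPolynomial.comp_aeval_apply]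
      simp only [AlgHom.comp_apply, ← h3]
    obtain ⟨k, hk, hgk⟩ := exists_comp_symAction_eq H φ₀ (φ₀.comp (symAction K V g)) h6
    have hgH := hp g hg k hk fun s => DFunLike.congr_fun hgk s
    refine hne (congrArg coeffPoly (funext fun j => ?_))
    have : h j ∈ symInvariants H := by
      rw [← hh]
      exact Algebra.subset_adjoin ⟨j, rfl⟩
    exact this g hgH

end CST

end

/-! ### Principal primes and the subgroup generated by pseudoreflections. -/

noncomputable section

namespace CST

open Polynomial Finset

variable {K : Type u} {V : Type v} [Field K] [AddCommGroup V] [Module K V]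

theorem eq_algebraMap_of_natDegree_gr {x : SymmetricAlgebra K V} (h : (gr x).natDegree = 0) :
    x = algebraMap K _ (SymmetricAlgebra.algebraMapInv x) := by
  have h1 := aeval_one_gr x
  rw [eq_C_of_natDegree_eq_zero h, eval_C, ← component_apply, component_zero] at h1
  exact h1.symm

/-- A linear form has degree one and a prime is not constant, so the prime takes up the whole
degree. -/
theorem eq_algebraMap_of_mul_eq_ι {p q : SymmetricAlgebra K V} (hp : Prime p) {a : V} (ha : a ≠ 0)
    (h : SymmetricAlgebra.ι K V a = p * q) :
    q = algebraMap K _ (SymmetricAlgebra.algebraMapInv q) := by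
  have h0 := ι_ne_zero (K := K) ha
  have hq : q ≠ 0 := by
    rintro rfl
    exact h0 (by rw [h, mul_zero])
  have h1 : (gr p).natDegree + (gr q).natDegree = 1 := by
    rw [← natDegree_mul ((map_ne_zero_iff _ gr_injective).mpr hp.ne_zero)
      ((map_ne_zero_iff _ gr_injective).mpr hq), ← map_mul, ← h, gr_ι, natDegree_monomial_eq _ h0]
  have h2 : (gr p).natDegree ≠ 0 := by
    intro h2
    have h3 := eq_algebraMap_of_natDegree_gr h2
    have h4 : (SymmetricAlgebra.algebraMapInv p : K) ≠ 0 := by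
      intro h4
      rw [h4, map_zero] at h3
      exact hp.ne_zero h3
    apply hp.not_isUnit
    rw [h3]
    exact h4.isUnit.map _
  exact eq_algebraMap_of_natDegree_gr (by omega)

/-- The linear forms divisible by a prime element are multiples of each other. -/
theorem exists_smul_eq_of_prime_dvd {p : SymmetricAlgebra K V} (hp : Prime p) {a b : V}
    (ha : a ≠ 0) (hpa : p ∣ SymmetricAlgebra.ι K V a) (hpb : p ∣ SymmetricAlgebra.ι K V b) :
    ∃ c : K, b = c • a := by
  rcases eq_or_ne b 0 with rfl | hb
  · exact ⟨0, (zero_smul K a).symm⟩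
  obtain ⟨q, hq⟩ := hpa
  obtain ⟨r, hr⟩ := hpb
  have hq' := eq_algebraMap_of_mul_eq_ι hp ha hq
  have hr' := eq_algebraMap_of_mul_eq_ι hp hb hr
  set c : K := SymmetricAlgebra.algebraMapInv q
  set d : K := SymmetricAlgebra.algebraMapInv r
  have hc : c ≠ 0 := by
    intro hc
    rw [hq', hc, map_zero, mul_zero] at hq
    exact ι_ne_zero ha hq
  refine ⟨d * c⁻¹, ι_injective (K := K) ?_⟩
  rw [map_smul, hq, hr, hq', hr', Algebra.smul_def, ← mul_assoc, mul_comm _ p, mul_assoc, ← map_mul,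
    mul_assoc, inv_mul_cancel₀ hc, mul_one]

/-- If two elements of `GL(V)` differ by a map whose image is a line, their quotient is a
pseudoreflection. -/
theorem isPseudoreflection_inv_mul {g k : LinearMap.GeneralLinearGroup K V} {a : V} (ha : a ≠ 0)
    {v₀ : V} (hv₀ : (g : V →ₗ[K] V) v₀ - (k : V →ₗ[K] V) v₀ = a)
    (h : ∀ v, ∃ c : K, (g : V →ₗ[K] V) v - (k : V →ₗ[K] V) v = c • a) :
    IsPseudoreflection (k⁻¹ * g) := by
  have hk : ∀ v, ((k⁻¹ : LinearMap.GeneralLinearGroup K V) : V →ₗ[K] V)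
      ((k : V →ₗ[K] V) v) = v := fun v => by
    rw [← Module.End.mul_apply, Units.inv_mul, Module.End.one_apply]
  have hk' : ∀ v, (k : V →ₗ[K] V)
      (((k⁻¹ : LinearMap.GeneralLinearGroup K V) : V →ₗ[K] V) v) = v := fun v => by
    rw [← Module.End.mul_apply, Units.mul_inv, Module.End.one_apply]
  have heq : ∀ v, (((k⁻¹ * g : LinearMap.GeneralLinearGroup K V) : V →ₗ[K] V) - 1) v =
      ((k⁻¹ : LinearMap.GeneralLinearGroup K V) : V →ₗ[K] V)
        ((g : V →ₗ[K] V) v - (k : V →ₗ[K] V) v) := fun v => by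
    rw [map_sub, hk]
    rfl
  have hrange : LinearMap.range (((k⁻¹ * g : LinearMap.GeneralLinearGroup K V) : V →ₗ[K] V) - 1) =
      Submodule.span K {((k⁻¹ : LinearMap.GeneralLinearGroup K V) : V →ₗ[K] V) a} := by
    apply le_antisymm
    · rintro _ ⟨v, rfl⟩
      obtain ⟨c, hc⟩ := h v
      rw [heq, hc, map_smul]
      exact Submodule.smul_mem _ _ (Submodule.mem_span_singleton_self _)
    · rw [Submodule.span_singleton_le_iff_mem]
      exact ⟨v₀, by rw [heq, hv₀]⟩
  rw [IsPseudoreflection, hrange, finrank_span_singleton]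
  intro h0
  apply ha
  rw [← hk' a, h0, map_zero]

/-- Modulo squares of the positive part only the constant and linear terms of a polynomial in the `h
j` remain, and the linear coefficients are the partial derivatives at the origin. -/
theorem aeval_sub_linear_mem {B : Subalgebra K (SymmetricAlgebra K V)} {n : ℕ}
    {h : Fin n → SymmetricAlgebra K V} (hh : ∀ i, h i ∈ posPart B)
    (F : MvPolynomial (Fin n) K) :
    MvPolynomial.aeval h F -
      algebraMap K _ (SymmetricAlgebra.algebraMapInv (MvPolynomial.aeval h F)) -
      ∑ j, (SymmetricAlgebra.algebraMapInv
        (MvPolynomial.aeval h (MvPolynomial.pderiv j F)) : K) • h j ∈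
      posPart B * posPart B := by
  have hB : ∀ F : MvPolynomial (Fin n) K, MvPolynomial.aeval h F ∈ B := by
    intro F
    have : MvPolynomial.aeval h F ∈ Algebra.adjoin K (Set.range h) := by
      rw [Algebra.adjoin_range_eq_range_aeval]
      exact ⟨F, rfl⟩
    refine Algebra.adjoin_le ?_ this
    rintro _ ⟨i, rfl⟩
    exact (hh i).1
  induction F using MvPolynomial.induction_on with
  | C r =>
    simp [← MvPolynomial.algebraMap_eq]
  | add p q hp hq =>
    convert add_mem hp hq using 1
    simp only [map_add, add_smul, sum_add_distrib]
    ring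
  | mul_X p i hp =>
    have h1 := Submodule.mul_mem_mul (sub_algebraMapInv_mem_posPart (hB p)) (hh i)
    convert h1 using 1
    have h2 : (SymmetricAlgebra.algebraMapInv (h i) : K) = 0 := (hh i).2
    have h3 : ∀ j, (SymmetricAlgebra.algebraMapInv (MvPolynomial.aeval h
        (MvPolynomial.pderiv j (p * MvPolynomial.X i))) : K) =
        if j = i then SymmetricAlgebra.algebraMapInv (MvPolynomial.aeval h p) else 0 := by
      intro j
      rw [MvPolynomial.pderiv_mul, MvPolynomial.pderiv_X, map_add, map_add, map_mul, map_mul,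
        map_mul, map_mul, MvPolynomial.aeval_X, h2, mul_zero, zero_add]
      split_ifs with hj
      · subst hj
        simp
      · simp [hj]
    simp only [h3, ite_smul, zero_smul, sum_ite_eq', mem_univ, if_true, map_mul,
      MvPolynomial.aeval_X, h2, map_zero, mul_zero, sub_zero]
    rw [Algebra.smul_def]
    ring

/-- For `D = 0` the zero ideal contains no nonzero linear form; otherwise an irreducible factor of
`D` generates the prime. -/
theorem exists_prime_of_not_isUnit [FiniteDimensional K V] {D : SymmetricAlgebra K V}
    (hD : ¬ IsUnit D) : ∃ p : Ideal (SymmetricAlgebra K V), p.IsPrime ∧ D ∈ p ∧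
      ∀ a b : V, a ≠ 0 → SymmetricAlgebra.ι K V a ∈ p → SymmetricAlgebra.ι K V b ∈ p →
        ∃ c : K, b = c • a := by
  rcases eq_or_ne D 0 with rfl | hD0
  · exact ⟨⊥, Ideal.isPrime_bot, rfl, fun a b ha ha' => absurd ha' (ι_ne_zero ha)⟩
  · obtain ⟨p, hp, hpD⟩ := WfDvdMonoid.exists_irreducible_factor hD hD0
    have hp' := hp.prime
    refine ⟨Ideal.span {p}, (Ideal.span_singleton_prime hp'.ne_zero).mpr hp',
      Ideal.mem_span_singleton.mpr hpD, fun a b ha ha' hb' => ?_⟩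
    exact exists_smul_eq_of_prime_dvd hp' ha (Ideal.mem_span_singleton.mp ha')
      (Ideal.mem_span_singleton.mp hb')

theorem closure_pseudoreflection_of_cotangentRankLE [FiniteDimensional K V]
    (Δ : Subgroup (LinearMap.GeneralLinearGroup K V)) [Finite Δ] (hΔ : (Nat.card Δ : K) ≠ 0)
    (hrank : CotangentRankLE (symInvariants Δ) (Module.finrank K V)) :
    Subgroup.closure {g | g ∈ Δ ∧ IsPseudoreflection g} = Δ := by
  set H := Subgroup.closure {g | g ∈ Δ ∧ IsPseudoreflection g} with hHdef
  have hH : H ≤ Δ := (Subgroup.closure_le _).mpr fun g hg => hg.1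
  have hHfin : Finite H := Finite.of_injective _ (Subgroup.inclusion_injective hH)
  have := Fintype.ofFinite H
  have hHcard : (Fintype.card H : K) ≠ 0 := by
    obtain ⟨k, hk⟩ := Subgroup.card_dvd_of_le hH
    rw [hk, Nat.cast_mul, Nat.card_eq_fintype_card] at hΔ
    exact left_ne_zero_of_mul hΔ
  have hHgen : Subgroup.closure {g | g ∈ H ∧ IsPseudoreflection g} = H := by
    apply le_antisymm
    · exact (Subgroup.closure_le _).mpr fun g hg => hg.1
    · exact Subgroup.closure_mono fun g hg => ⟨Subgroup.subset_closure hg, hg.2⟩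
  have hfree := free_of_closure_pseudoreflection H hHcard hHgen
  have hHrank : CotangentRankLE (symInvariants H) (Module.finrank K V) :=
    fun m f hf hli => card_le_finrank_of_free H f hf hli
  obtain ⟨h, hhpos, -, hh, hind⟩ := exists_polynomial_generators H hHrank
  obtain ⟨f, hfpos, hfhom, hf, -⟩ := exists_polynomial_generators Δ hrank
  have hle : symInvariants Δ ≤ symInvariants H := fun x hx g hg => hx g (hH hg)
  have hF : ∀ i, ∃ F, MvPolynomial.aeval (R := K) h F = f i := by
    intro i
    have h1 := hle (hfpos i).1
    rw [← hh, Algebra.adjoin_range_eq_range_aeval] at h1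
    exact h1
  choose F hF using hF
  let M : Matrix (Fin (Module.finrank K V)) (Fin (Module.finrank K V)) (SymmetricAlgebra K V) :=
    Matrix.of fun i j => MvPolynomial.aeval h (MvPolynomial.pderiv j (F i))
  have hunit : IsUnit M.det := by
    by_contra hnot
    obtain ⟨p, hp, hMp, hlin⟩ := exists_prime_of_not_isUnit hnot
    let L := FractionRing (SymmetricAlgebra K V ⧸ p)
    let φ₀ : SymmetricAlgebra K V →ₐ[K] L :=
      (IsScalarTower.toAlgHom K (SymmetricAlgebra K V ⧸ p) L).comp (Ideal.Quotient.mkₐ K p)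
    have hφ₀ : ∀ x, φ₀ x = 0 ↔ x ∈ p := by
      intro x
      rw [← Ideal.Quotient.eq_zero_iff_mem]
      exact map_eq_zero_iff _ (IsFractionRing.injective (SymmetricAlgebra K V ⧸ p) L)
    have hdet : (M.map φ₀).det = 0 := by
      have := (hφ₀ _).mpr hMp
      rwa [AlgHom.map_det] at this
    obtain ⟨v, hv0, hv⟩ := Matrix.exists_mulVec_eq_zero_iff.mpr hdet
    refine hv0 (jacobian_injective Δ H hH hind hh hf hF φ₀ ?_ v fun i => congrFun hv i)
    -- If `g` and `k` agree modulo `p`, all differences `g v - k v` give linear forms in `p`, hence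
    -- lie on one line, and `k⁻¹ * g` is a pseudoreflection or trivial.
    intro g hg k hk hgk
    by_cases hgk' : g = k
    · rw [hgk']
      exact hk
    have hmem : ∀ v, SymmetricAlgebra.ι K V ((g : V →ₗ[K] V) v - (k : V →ₗ[K] V) v) ∈ p := by
      intro v
      rw [← hφ₀, map_sub, map_sub, ← symAction_ι, ← symAction_ι, hgk, sub_self]
    obtain ⟨v₀, hv₀⟩ : ∃ v, (g : V →ₗ[K] V) v - (k : V →ₗ[K] V) v ≠ 0 := by
      by_contra! hall
      exact hgk' (Units.ext (LinearMap.ext fun v => sub_eq_zero.mp (hall v)))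
    have hrefl := isPseudoreflection_inv_mul hv₀ rfl fun v =>
      hlin _ _ hv₀ (hmem v₀) (hmem v)
    have h1 : k⁻¹ * g ∈ H :=
      Subgroup.subset_closure ⟨Δ.mul_mem (Δ.inv_mem (hH hk)) hg, hrefl⟩
    have h2 := H.mul_mem hk h1
    rwa [mul_inv_cancel_left] at h2
  -- The Jacobian at the origin expresses the `f i` through the `h j` modulo squares. Inverting it
  -- puts each `h j` in `W`, so the `f i` generate the invariants of `H`.
  let M₀ : Matrix (Fin (Module.finrank K V)) (Fin (Module.finrank K V)) K :=
    M.map SymmetricAlgebra.algebraMapInv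
  have hM₀ : IsUnit M₀.det := by
    have := hunit.map (SymmetricAlgebra.algebraMapInv : SymmetricAlgebra K V →ₐ[K] K)
    rwa [AlgHom.map_det] at this
  set W := Submodule.span K (Set.range f) ⊔
    posPart (symInvariants H) * posPart (symInvariants H) with hW
  have hlin : ∀ i, ∑ j, M₀ i j • h j ∈ W := by
    intro i
    have h1 := aeval_sub_linear_mem hhpos (F i)
    rw [hF, show (SymmetricAlgebra.algebraMapInv (f i) : K) = 0 from (hfpos i).2, map_zero,
      sub_zero] at h1
    have h2 : f i ∈ W := Submodule.mem_sup_left (Submodule.subset_span ⟨i, rfl⟩)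
    have h3 := sub_mem h2 (Submodule.mem_sup_right (S := Submodule.span K (Set.range f)) h1)
    rwa [sub_sub_cancel] at h3
  have hhW : ∀ j, h j ∈ W := by
    intro j
    have h1 : ∑ i, M₀⁻¹ j i • ∑ k, M₀ i k • h k ∈ W :=
      sum_mem fun i _ => Submodule.smul_mem _ _ (hlin i)
    have h2 : ∑ i, M₀⁻¹ j i • ∑ k, M₀ i k • h k = h j := by
      simp only [smul_sum, smul_smul]
      rw [sum_comm]
      simp only [← sum_smul, ← Matrix.mul_apply, Matrix.nonsing_inv_mul M₀ hM₀, Matrix.one_apply,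
        ite_smul, one_smul, zero_smul, sum_ite_eq, mem_univ, if_true]
    rwa [h2] at h1
  have hpos : posPart (symInvariants H) ≤ W := by
    intro x hx
    have hx1 := hx.1
    have hx' : x ∈ Algebra.adjoin K (Set.range h) := by
      rw [hh]
      exact hx1
    rw [Algebra.adjoin_range_eq_range_aeval] at hx'
    obtain ⟨P, hP⟩ := hx'
    have h1 := aeval_sub_linear_mem hhpos P
    have hP' : MvPolynomial.aeval h P = x := hP
    rw [hP', mem_augIdeal.mp hx.2, map_zero, sub_zero] at h1
    have h2 := add_mem (Submodule.mem_sup_right (S := Submodule.span K (Set.range f)) h1)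
      (sum_mem fun j (_ : j ∈ univ) => Submodule.smul_mem W (SymmetricAlgebra.algebraMapInv
        (MvPolynomial.aeval h (MvPolynomial.pderiv j P)) : K) (hhW j))
    rwa [sub_add_cancel] at h2
  have heq := adjoin_eq_of_posPart_le (isGraded_symInvariants H) f (fun i => hle (hfpos i).1)
    hfhom hpos
  rw [hf] at heq
  refine le_antisymm hH fun g hg => ?_
  -- Each `g ∈ Δ` now fixes the invariants of `H`, so its action is that of an element of `H`.
  obtain ⟨k, hk, hgk⟩ := exists_comp_symAction_eq H (AlgHom.id K _) (symAction K V g) fun r hr => by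
    rw [← heq] at hr
    exact hr g hg
  rw [AlgHom.id_comp] at hgk
  rwa [symAction_injective hgk]

end CST

end

/-! ### Invariants of the completion and their truncations. -/

noncomputable section

namespace CST

open Polynomial Finset

/-- The image of `J` lies in the image of `I`, whose `k`-th power is zero. -/
theorem pow_le_ker_of_forall_exists {A R : Type*} [CommRing A] [CommRing R] {I : Ideal R} {k : ℕ}
    (τ : A →+* R ⧸ I ^ k) {J : Ideal A}
    (h : ∀ a ∈ J, ∃ r ∈ I, τ a = Ideal.Quotient.mk (I ^ k) r) : J ^ k ≤ RingHom.ker τ := by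
  have h1 : J.map τ ≤ I.map (Ideal.Quotient.mk (I ^ k)) := by
    refine Ideal.map_le_iff_le_comap.mpr fun a ha => ?_
    obtain ⟨r, hr, hra⟩ := h a ha
    rw [Ideal.mem_comap, hra]
    exact Ideal.mem_map_of_mem _ hr
  have h2 := Ideal.pow_right_mono h1 k
  rw [← Ideal.map_pow, ← Ideal.map_pow, Ideal.map_quotient_self, le_bot_iff] at h2
  exact (Ideal.map_eq_bot_iff_le_ker τ).mp h2

theorem exists_algHom_quotient {K A R Q : Type*} [CommRing K] [CommRing A] [CommRing R]
    [CommRing Q] [Algebra K A] [Algebra K R] [Algebra K Q] (p : A →ₐ[K] Q) (q : R →ₐ[K] Q)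
    (h : ∀ a, ∃ r, p a = q r) {J : Ideal R} (hJ : ∀ r, q r = 0 → r ∈ J) :
    ∃ τ : A →ₐ[K] R ⧸ J, ∀ a r, p a = q r → τ a = Ideal.Quotient.mk J r := by
  choose ρ hρ using h
  have key : ∀ a r, p a = q r → Ideal.Quotient.mk J (ρ a) = Ideal.Quotient.mk J r := by
    intro a r har
    rw [Ideal.Quotient.eq]
    exact hJ _ (by rw [map_sub, ← hρ, har, sub_self])
  exact ⟨{
    toFun := fun a => Ideal.Quotient.mk J (ρ a)
    map_one' := key 1 1 (by simp)
    map_zero' := key 0 0 (by simp)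
    map_mul' := fun a b => (key (a * b) (ρ a * ρ b) (by simp [← hρ])).trans (map_mul _ _ _)
    map_add' := fun a b => (key (a + b) (ρ a + ρ b) (by simp [← hρ])).trans (map_add _ _ _)
    commutes' := fun c => key (algebraMap K _ c) (algebraMap K _ c) (by simp) }, key⟩

section Reynolds

variable {K : Type*} {A : Type*} [Field K] [CommRing A] [Algebra K A] {G : Type*} [Group G]
  (φ : G →* (A →ₐ[K] A)) (Δ : Subgroup G) [Fintype Δ]

/-- The averaging operator maps the extension of an ideal of the invariants into that ideal. -/
theorem reynolds_mem_of_mem_map (a : Ideal (invariants φ Δ)) {x : A}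
    (hx : x ∈ a.map (algebraMap (invariants φ Δ) A)) :
    (⟨reynolds φ Δ x, reynolds_mem φ Δ x⟩ : invariants φ Δ) ∈ a := by
  obtain ⟨k, b, y, h⟩ := Submodule.mem_span_set'.mp hx
  have hy : ∀ i, ∃ r ∈ a, (r : A) = y i := fun i => (y i).2
  choose r hr hry using hy
  have h1 : (⟨reynolds φ Δ x, reynolds_mem φ Δ x⟩ : invariants φ Δ) =
      ∑ i, (⟨reynolds φ Δ (b i), reynolds_mem φ Δ (b i)⟩ : invariants φ Δ) * r i := by
    apply Subtype.ext
    push_cast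
    rw [← h, map_sum]
    refine sum_congr rfl fun i _ => ?_
    rw [smul_eq_mul, ← hry, mul_comm, reynolds_mul φ Δ (r i).2, mul_comm]
  rw [h1]
  exact sum_mem fun i _ => Ideal.mul_mem_left _ _ (hr i)

end Reynolds

variable {K : Type u} {V : Type v} [Field K] [AddCommGroup V] [Module K V]

theorem augIdeal_fg [FiniteDimensional K V] : (augIdeal K V).FG := by
  rw [augIdeal_eq_range_linearCombination (Module.finBasis K V), Fintype.range_linearCombination]
  exact Submodule.fg_span (Set.finite_range _)

theorem proj_algebraMap (n : ℕ) (s : SymmetricAlgebra K V) :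
    proj K V n (algebraMap _ _ s) = Ideal.Quotient.mk _ s :=
  (AdicCompletion.evalₐ (augIdeal K V) n).commutes s

theorem completedSym_ext {x y : CompletedSym K V} (h : ∀ n, proj K V n x = proj K V n y) : x = y :=
  AdicCompletion.ext_evalₐ h

theorem proj_surjective_mk (n : ℕ) (x : CompletedSym K V) :
    ∃ s, proj K V n x = Ideal.Quotient.mk _ s :=
  (Ideal.Quotient.mk_surjective (proj K V n x)).imp fun _ h => h.symm

theorem proj_eq_mk_of_le {m n : ℕ} (hmn : m ≤ n) {x : CompletedSym K V}
    {s : SymmetricAlgebra K V} (h : proj K V n x = Ideal.Quotient.mk _ s) :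
    proj K V m x = Ideal.Quotient.mk _ s := by
  obtain ⟨y, rfl⟩ := AdicCompletion.mk_surjective _ _ x
  have h1 : ∀ k, proj K V k (AdicCompletion.mk _ _ y) = Ideal.Quotient.mk _ (y.val k) :=
    fun k => AdicCompletion.evalₐ_mk _ k y
  rw [h1, Ideal.Quotient.eq] at h
  rw [h1, ← AdicCompletion.Ideal.mk_eq_mk (augIdeal K V) hmn y]
  exact Ideal.Quotient.eq.mpr (Ideal.pow_le_pow_right hmn h)

theorem completedAction_algebraMap (g : LinearMap.GeneralLinearGroup K V)
    (s : SymmetricAlgebra K V) : completedAction K V g (algebraMap _ _ s) =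
      algebraMap _ _ (symAction K V g s) := by
  refine completedSym_ext fun n => ?_
  refine (proj_completedMap K V g n _).trans ?_
  rw [proj_algebraMap, proj_algebraMap]
  rfl

theorem mem_completedMaxIdeal_iff {n : ℕ} (hn : n ≠ 0) {x : CompletedSym K V}
    {s : SymmetricAlgebra K V} (h : proj K V n x = Ideal.Quotient.mk _ s) :
    x ∈ completedMaxIdeal K V ↔ s ∈ augIdeal K V := by
  have h1 := proj_eq_mk_of_le (Nat.one_le_iff_ne_zero.mpr hn) h
  have h2 : AdicCompletion.evalOneₐ (augIdeal K V) x = Ideal.Quotient.mk _ s := by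
    rw [← AdicCompletion.factorₐ_evalₐ_one]
    exact (congrArg _ h1).trans (Ideal.Quotient.factor_mk _ _)
  rw [completedMaxIdeal, RingHom.mem_ker, h2, Ideal.Quotient.eq_zero_iff_mem]

/-- Finite generation of the augmentation ideal makes the kernel of a truncation the extension of
the corresponding power. -/
theorem mem_map_of_proj_eq_zero [FiniteDimensional K V] {n : ℕ} {x : CompletedSym K V}
    (h : proj K V n x = 0) :
    x ∈ (augIdeal K V ^ n).map (algebraMap (SymmetricAlgebra K V) (CompletedSym K V)) := by
  have h1 : x ∈ (AdicCompletion.eval (augIdeal K V) (SymmetricAlgebra K V) n).ker := by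
    have hle : augIdeal K V ^ n ≤ augIdeal K V ^ n • ⊤ := by simp
    rw [LinearMap.mem_ker]
    refine (AdicCompletion.factor_evalₐ_eq_eval _ x hle).symm.trans ?_
    exact (congrArg _ h).trans (map_zero _)
  rw [← AdicCompletion.pow_smul_top_eq_ker_eval augIdeal_fg] at h1
  refine Submodule.smul_induction_on h1 (fun r hr y _ => ?_) fun _ _ => add_mem
  rw [Algebra.smul_def]
  exact Ideal.mul_mem_right _ _ (Ideal.mem_map_of_mem _ hr)

/-- The ideal of invariants without constant term. -/
def symInvariantsIdeal (Δ : Subgroup (LinearMap.GeneralLinearGroup K V)) :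
    Ideal (symInvariants Δ) :=
  (augIdeal K V).comap (symInvariants Δ).val

theorem map_symInvariantsIdeal (Δ : Subgroup (LinearMap.GeneralLinearGroup K V)) :
    (symInvariantsIdeal Δ).map (algebraMap (symInvariants Δ) (SymmetricAlgebra K V)) =
      hilbertIdeal Δ := by
  rw [Ideal.map, hilbertIdeal]
  congr 1
  ext x
  constructor
  · rintro ⟨r, hr, rfl⟩
    exact ⟨r.2, hr⟩
  · rintro ⟨h1, h2⟩
    exact ⟨⟨x, h1⟩, h2, rfl⟩

/-- The constant term is invariant, so the orbit polynomial of `x` reduces to a power of `X` under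
it. Its lower coefficients therefore lie in the positive part of the invariants, and evaluating at
`x` puts a power of `x` in the Hilbert ideal. -/
theorem augIdeal_le_radical (Δ : Subgroup (LinearMap.GeneralLinearGroup K V)) [Finite Δ] :
    augIdeal K V ≤ (hilbertIdeal Δ).radical := by
  have := Fintype.ofFinite Δ
  intro x hx
  obtain ⟨q, hq, h⟩ := exists_map_eq_prod_orbit (φ := symAction K V) (Δ := Δ) x
  set d := q.natDegree
  have hcoeff : ∀ k < d, ((q.coeff k : symInvariants Δ) : SymmetricAlgebra K V) ∈
      posPart (symInvariants Δ) := by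
    intro k hk
    refine ⟨(q.coeff k).2, ?_⟩
    change SymmetricAlgebra.algebraMapInv _ = (0 : K)
    have h1 := congrArg (fun p => (p.map (SymmetricAlgebra.algebraMapInv (R := K) (M := V) :
      SymmetricAlgebra K V →+* K)).coeff k) h
    have h2 : ∏ c ∈ orbitFinset (symAction K V) Δ x, ((X - C c).map
        (SymmetricAlgebra.algebraMapInv (R := K) (M := V) : SymmetricAlgebra K V →+* K)) =
        X ^ (orbitFinset (symAction K V) Δ x).card := by
      rw [← prod_const]
      refine prod_congr rfl fun c hc => ?_
      obtain ⟨g, -, rfl⟩ := mem_orbitFinset.mp hc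
      have h3 : (SymmetricAlgebra.algebraMapInv (symAction K V g x) : K) = 0 := by
        rw [algebraMapInv_symAction]
        exact hx
      simp [h3]
    have h4 : (orbitFinset (symAction K V) Δ x).card = d := by
      have := congrArg natDegree h
      rw [hq.natDegree_map, natDegree_prod_of_monic _ _ fun c _ => monic_X_sub_C c] at this
      simpa using this.symm
    simp only [Polynomial.map_prod] at h1
    rw [h2, h4, coeff_X_pow, if_neg hk.ne, coeff_map, coeff_map] at h1
    exact h1
  have heval : (q.map (algebraMap (symInvariants Δ) (SymmetricAlgebra K V))).eval x = 0 := by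
    rw [h, eval_prod]
    exact prod_eq_zero (self_mem_orbitFinset x) (by simp)
  rw [eval_eq_sum_range, hq.natDegree_map, sum_range_succ] at heval
  refine ⟨d, ?_⟩
  have h5 : (q.map (algebraMap (symInvariants Δ) (SymmetricAlgebra K V))).coeff d = 1 := by
    rw [coeff_map, hq.coeff_natDegree, map_one]
  rw [h5, one_mul] at heval
  rw [eq_neg_of_add_eq_zero_right heval]
  refine neg_mem (sum_mem fun k hk => Ideal.mul_mem_right _ _ (Ideal.subset_span ?_))
  rw [coeff_map]
  exact hcoeff k (mem_range.mp hk)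

theorem exists_pow_augIdeal_le [FiniteDimensional K V]
    (Δ : Subgroup (LinearMap.GeneralLinearGroup K V)) [Finite Δ] (k : ℕ) :
    ∃ n ≠ 0, augIdeal K V ^ n ≤
      (symInvariantsIdeal Δ ^ k).map (algebraMap (symInvariants Δ) (SymmetricAlgebra K V)) := by
  obtain ⟨n, hn⟩ := Ideal.exists_pow_le_of_le_radical_of_fg (augIdeal_le_radical Δ) augIdeal_fg
  -- The `+ 1` keeps the exponent nonzero, as `mem_completedMaxIdeal_iff` requires.
  refine ⟨n * k + 1, Nat.succ_ne_zero _, ?_⟩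
  rw [Ideal.map_pow, map_symInvariantsIdeal]
  refine (Ideal.pow_le_pow_right (Nat.le_succ _)).trans ?_
  rw [pow_mul]
  exact Ideal.pow_right_mono hn k

/-- The inclusion of the invariants of `S(V)` in those of `P(V)`. -/
def toCompletedInvariants (Δ : Subgroup (LinearMap.GeneralLinearGroup K V)) :
    symInvariants Δ →ₐ[K] completedInvariants Δ where
  toFun r := ⟨algebraMap _ _ (r : SymmetricAlgebra K V), fun g hg => by
    rw [completedAction_algebraMap, r.2 g hg]⟩
  map_one' := Subtype.ext (map_one _)
  map_zero' := Subtype.ext (map_zero _)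
  map_mul' _ _ := Subtype.ext (map_mul _ _ _)
  map_add' _ _ := Subtype.ext (map_add _ _ _)
  commutes' _ := Subtype.ext rfl

section

variable (Δ : Subgroup (LinearMap.GeneralLinearGroup K V))

theorem proj_toCompletedInvariants (n : ℕ) (r : symInvariants Δ) :
    proj K V n (toCompletedInvariants Δ r : CompletedSym K V) =
      Ideal.Quotient.mk _ (r : SymmetricAlgebra K V) :=
  proj_algebraMap n _

theorem toCompletedInvariants_mem_iff (r : symInvariants Δ) :
    toCompletedInvariants Δ r ∈ invariantsMaxIdeal Δ ↔ r ∈ symInvariantsIdeal Δ :=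
  mem_completedMaxIdeal_iff one_ne_zero (proj_toCompletedInvariants Δ 1 r)

theorem map_toCompletedInvariants_le (k : ℕ) :
    (symInvariantsIdeal Δ ^ k).map (toCompletedInvariants Δ) ≤ invariantsMaxIdeal Δ ^ k := by
  rw [Ideal.map_pow]
  refine Ideal.pow_right_mono (Ideal.map_le_iff_le_comap.mpr fun r hr => ?_) k
  exact (toCompletedInvariants_mem_iff Δ r).mpr hr

variable [Fintype Δ]

theorem proj_reynolds {n : ℕ} {x : CompletedSym K V} {s : SymmetricAlgebra K V}
    (h : proj K V n x = Ideal.Quotient.mk _ s) :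
    proj K V n (reynolds (completedAction K V) Δ x) =
      Ideal.Quotient.mk _ (reynolds (symAction K V) Δ s) := by
  change _ = Ideal.Quotient.mkₐ K _ _
  rw [reynolds_apply, reynolds_apply, map_smul, map_sum, map_smul, map_sum]
  congr 1
  refine sum_congr rfl fun g _ => (proj_completedMap K V g n x).trans ?_
  rw [h]
  rfl

theorem exists_proj_eq (hΔ : (Fintype.card Δ : K) ≠ 0) (n : ℕ) (a : completedInvariants Δ) :
    ∃ r : symInvariants Δ, proj K V n (a : CompletedSym K V) =
      Ideal.Quotient.mk _ (r : SymmetricAlgebra K V) := by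
  obtain ⟨s, hs⟩ := proj_surjective_mk n (a : CompletedSym K V)
  have h := proj_reynolds Δ hs
  rw [reynolds_eq_self _ _ hΔ a.2] at h
  exact ⟨⟨_, reynolds_mem (symAction K V) Δ s⟩, h⟩

variable [FiniteDimensional K V]

/-- Density of the invariants of S(V). An averaged truncation of `a` differs from it by an invariant
in the extension to P(V) of a power of the ideal; averaging brings this back to the power inside the
invariants. -/
theorem exists_sub_mem_pow (hΔ : (Fintype.card Δ : K) ≠ 0) (k : ℕ) (a : completedInvariants Δ) :
    ∃ r : symInvariants Δ, a - toCompletedInvariants Δ r ∈ invariantsMaxIdeal Δ ^ k := by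
  obtain ⟨n, -, hn⟩ := exists_pow_augIdeal_le Δ k
  obtain ⟨r, hr⟩ := exists_proj_eq Δ hΔ n a
  refine ⟨r, ?_⟩
  set b := a - toCompletedInvariants Δ r with hb
  have h1 : proj K V n (b : CompletedSym K V) = 0 := by
    rw [hb, AddSubgroupClass.coe_sub, map_sub, hr, proj_toCompletedInvariants, sub_self]
  have h2 : (b : CompletedSym K V) ∈ ((symInvariantsIdeal Δ ^ k).map
      (toCompletedInvariants Δ)).map (algebraMap (completedInvariants Δ) (CompletedSym K V)) := by
    have h3 := Ideal.map_mono hn (mem_map_of_proj_eq_zero h1)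
    rw [Ideal.map_map] at h3
    have : ((symInvariantsIdeal Δ ^ k).map (toCompletedInvariants Δ)).map
        (algebraMap (completedInvariants Δ) (CompletedSym K V)) =
        (symInvariantsIdeal Δ ^ k).map ((algebraMap (completedInvariants Δ) (CompletedSym K V)).comp
          (toCompletedInvariants Δ : symInvariants Δ →+* completedInvariants Δ)) :=
      Ideal.map_map _ _
    rw [this]
    exact h3
  have h4 := reynolds_mem_of_mem_map (completedAction K V) Δ _ h2
  have h5 : (⟨_, reynolds_mem (completedAction K V) Δ b⟩ : completedInvariants Δ) = b :=
    Subtype.ext (reynolds_eq_self _ _ hΔ b.2)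
  rw [h5] at h4
  exact map_toCompletedInvariants_le Δ k h4

/-- The invariants of `P(V)` map onto the truncations of the invariants of `S(V)`. -/
theorem exists_truncation (hΔ : (Fintype.card Δ : K) ≠ 0) (k : ℕ) :
    ∃ τ : completedInvariants Δ →ₐ[K] symInvariants Δ ⧸ symInvariantsIdeal Δ ^ k,
      (∀ r, τ (toCompletedInvariants Δ r) = Ideal.Quotient.mk _ r) ∧
      invariantsMaxIdeal Δ ^ k ≤ RingHom.ker τ := by
  obtain ⟨n, hn0, hn⟩ := exists_pow_augIdeal_le Δ k
  have hker : ∀ r : symInvariants Δ,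
      ((Ideal.Quotient.mkₐ K (augIdeal K V ^ n)).comp (symInvariants Δ).val) r = 0 →
      r ∈ symInvariantsIdeal Δ ^ k := by
    intro r hr
    have h1 := reynolds_mem_of_mem_map (symAction K V) Δ _
      (hn (Ideal.Quotient.eq_zero_iff_mem.mp hr))
    have h2 : (⟨_, reynolds_mem (symAction K V) Δ r⟩ : symInvariants Δ) = r :=
      Subtype.ext (reynolds_eq_self _ _ hΔ r.2)
    rwa [← h2]
  obtain ⟨τ, hτ⟩ := exists_algHom_quotient ((proj K V n).comp (completedInvariants Δ).val)
    ((Ideal.Quotient.mkₐ K (augIdeal K V ^ n)).comp (symInvariants Δ).val)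
    (exists_proj_eq Δ hΔ n) hker
  refine ⟨τ, fun r => hτ _ r (proj_toCompletedInvariants Δ n r), ?_⟩
  refine pow_le_ker_of_forall_exists τ.toRingHom fun a ha => ?_
  obtain ⟨r, hr⟩ := exists_proj_eq Δ hΔ n a
  exact ⟨r, (mem_completedMaxIdeal_iff hn0 hr).mp ha, hτ a r hr⟩

end

end CST

end

/-! ### Formal smoothness, in both directions. -/

noncomputable section

namespace CST

open Finset

section Lifting

variable {K : Type u} [Field K]

/-- A formally smooth dense subalgebra inducing the adic topology makes the algebra formally
smooth. -/
theorem isAdicFormallySmooth_of_formallySmooth {R : Type*} {A : Type v} [CommRing R] [CommRing A]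
    [Algebra K R] [Algebra K A] [Algebra.FormallySmooth K R] (i : R →ₐ[K] A) {I : Ideal R}
    {J : Ideal A} (hIJ : I.map i ≤ J) (hdense : ∀ k a, ∃ r, a - i r ∈ J ^ k)
    (hτ : ∀ k, ∃ τ : A →ₐ[K] R ⧸ I ^ k,
      (∀ r, τ (i r) = Ideal.Quotient.mk _ r) ∧ J ^ k ≤ RingHom.ker τ) :
    IsAdicFormallySmooth K J := by
  intro C _ _ Q hQ f ⟨k, hk⟩
  obtain ⟨g, hg⟩ := Algebra.FormallySmooth.exists_lift Q ⟨2, hQ⟩ (f.comp i)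
  have hg' : ∀ r, Ideal.Quotient.mk Q (g r) = f (i r) := fun r => DFunLike.congr_fun hg r
  have h1 : (I ^ k).map g ≤ Q := by
    refine Ideal.map_le_iff_le_comap.mpr fun r hr => ?_
    rw [Ideal.mem_comap, ← Ideal.Quotient.eq_zero_iff_mem, hg']
    apply hk
    have h2 : i r ∈ (I ^ k).map i := Ideal.mem_map_of_mem _ hr
    have h3 : (I ^ k).map i = I.map i ^ k := Ideal.map_pow i I k
    rw [h3] at h2
    exact Ideal.pow_right_mono hIJ k h2
  have h2 : ∀ r ∈ I ^ (2 * k), g r = 0 := by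
    intro r hr
    have h3 : g r ∈ (I ^ (2 * k)).map g := Ideal.mem_map_of_mem _ hr
    have h4 : (I ^ (2 * k)).map g = (I ^ k).map g ^ 2 := by
      rw [mul_comm, pow_mul]
      exact Ideal.map_pow g (I ^ k) 2
    rw [h4] at h3
    have h5 := Ideal.pow_right_mono h1 2 h3
    rwa [hQ] at h5
  obtain ⟨τ, hτi, hτk⟩ := hτ (2 * k)
  let g' : R ⧸ I ^ (2 * k) →ₐ[K] C := Ideal.Quotient.liftₐ _ g h2
  refine ⟨g'.comp τ, ⟨2 * k, fun a ha => ?_⟩, ?_⟩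
  · have : τ a = 0 := hτk ha
    rw [RingHom.mem_ker, AlgHom.comp_apply, this, map_zero]
  · ext a
    obtain ⟨r, hr⟩ := hdense (2 * k) a
    have h3 : τ a = Ideal.Quotient.mk _ r := by
      rw [← hτi, ← sub_eq_zero, ← map_sub]
      exact hτk hr
    have h4 : f a = f (i r) := by
      rw [← sub_eq_zero, ← map_sub]
      exact hk (Ideal.pow_le_pow_right (by omega) hr)
    rw [h4, ← hg', AlgHom.comp_apply, AlgHom.comp_apply, h3]
    rfl

open MvPolynomial

/-- A polynomial map tangent to the identity preserves initial forms. -/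
theorem aeval_sub_mem_pow {σ : Type*} {y : σ → MvPolynomial σ K}
    (hy : ∀ j, y j - X j ∈ idealOfVars σ K ^ 2) (d : ℕ) {P : MvPolynomial σ K}
    (hP : P ∈ idealOfVars σ K ^ d) : aeval y P - P ∈ idealOfVars σ K ^ (d + 1) := by
  set I := idealOfVars σ K
  have hX : ∀ j, (X j : MvPolynomial σ K) ∈ I := fun j => Ideal.subset_span ⟨j, rfl⟩
  have hyI : ∀ j, y j ∈ I := fun j => by
    have := add_mem (Ideal.pow_le_self two_ne_zero (hy j)) (hX j)
    rwa [sub_add_cancel] at this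
  have hmap : I.map (aeval y) ≤ I := by
    rw [Ideal.map_span, Ideal.span_le]
    rintro _ ⟨_, ⟨j, rfl⟩, rfl⟩
    rw [aeval_X]
    exact hyI j
  have hpow : ∀ d, ∀ Q ∈ I ^ d, aeval y Q ∈ I ^ d := by
    intro d Q hQ
    have h1 : aeval y Q ∈ (I ^ d).map (aeval y) := Ideal.mem_map_of_mem _ hQ
    have h2 : (I ^ d).map (aeval y) = I.map (aeval y) ^ d := Ideal.map_pow (aeval y) I d
    rw [h2] at h1
    exact Ideal.pow_right_mono hmap d h1
  have h0 : ∀ Q, aeval y Q - Q ∈ I := by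
    intro Q
    induction Q using MvPolynomial.induction_on with
    | C c =>
      rw [aeval_C, MvPolynomial.algebraMap_eq, sub_self]
      exact zero_mem _
    | add p q hp hq =>
      convert add_mem hp hq using 1
      rw [map_add]
      ring
    | mul_X p j hp =>
      rw [map_mul, aeval_X]
      exact sub_mem (Ideal.mul_mem_left _ _ (hyI j)) (Ideal.mul_mem_left _ _ (hX j))
  have h1 : ∀ Q ∈ I, aeval y Q - Q ∈ I ^ 2 := by
    intro Q hQ
    induction hQ using Submodule.span_induction with
    | mem x hx =>
      obtain ⟨j, rfl⟩ := hx
      rw [aeval_X]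
      exact hy j
    | zero => simp
    | add p q _ _ hp hq =>
      convert add_mem hp hq using 1
      rw [map_add]
      ring
    | smul a x hx hxI =>
      have h2 : aeval y (a • x) - a • x = aeval y a * (aeval y x - x) + (aeval y a - a) * x := by
        rw [smul_eq_mul, map_mul]
        ring
      rw [h2]
      refine add_mem (Ideal.mul_mem_left _ _ hxI) ?_
      rw [pow_two]
      exact Ideal.mul_mem_mul (h0 a) hx
  induction d generalizing P with
  | zero =>
    rw [zero_add, pow_one]
    exact h0 P
  | succ d ih =>
    rw [pow_succ] at hP
    refine Submodule.mul_induction_on hP (fun a ha b hb => ?_) fun p q hp hq => ?_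
    · have h2 : aeval y (a * b) - a * b =
          (aeval y a - a) * aeval y b + a * (aeval y b - b) := by
        rw [map_mul]
        ring
      rw [h2]
      refine add_mem ?_ ?_
      · have := Ideal.mul_mem_mul (ih ha) (hpow 1 b (by rwa [pow_one]))
        rwa [← pow_add] at this
      · have := Ideal.mul_mem_mul ha (h1 b hb)
        rwa [← pow_add] at this
    · convert add_mem hp hq using 1
      rw [map_add]
      ring

/-- Since substituting `y` preserves initial forms, `P` has the same order at the origin as its
substitution, up to `k`; Krull's intersection theorem concludes. -/
theorem eq_zero_of_forall_exists_aeval_mem {σ : Type*} [Finite σ] {P : MvPolynomial σ K}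
    (h : ∀ k, ∃ y : σ → MvPolynomial σ K, (∀ j, y j - X j ∈ idealOfVars σ K ^ 2) ∧
      aeval y P ∈ idealOfVars σ K ^ k) : P = 0 := by
  have h1 : ∀ k, P ∈ idealOfVars σ K ^ k := by
    intro k
    obtain ⟨y, hy, hyP⟩ := h k
    have h2 : ∀ d ≤ k, P ∈ idealOfVars σ K ^ d := by
      intro d
      induction d with
      | zero => simp
      | succ d ih =>
        intro hd
        have := sub_mem (Ideal.pow_le_pow_right hd hyP) (aeval_sub_mem_pow hy d (ih (by omega)))
        rwa [sub_sub_cancel] at this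
    exact h2 k le_rfl
  have h2 : idealOfVars σ K ≠ ⊤ := by
    rw [Ideal.ne_top_iff_one, ← pow_one (idealOfVars σ K), ← C_1, C_mem_pow_idealOfVars_iff]
    simp
  have h3 := Ideal.iInf_pow_eq_bot_of_isDomain (idealOfVars σ K) h2
  rw [← Ideal.mem_bot, ← h3]
  exact (Submodule.mem_iInf _).mpr h1

theorem exists_lift_quotient_of_sq_le {A : Type v} [CommRing A] [Algebra K A] {J : Ideal A}
    (h : IsAdicFormallySmooth K J) {B : Type (max u v)} [CommRing B] [Algebra K B]
    {I₁ I₂ : Ideal B} (hle : I₁ ≤ I₂) (hsq : I₂ ^ 2 ≤ I₁) (g : A →ₐ[K] B ⧸ I₂)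
    (hg : ∃ n, J ^ n ≤ RingHom.ker g) :
    ∃ g' : A →ₐ[K] B ⧸ I₁, (∃ n, J ^ n ≤ RingHom.ker g') ∧
      (Ideal.Quotient.factorₐ K hle).comp g' = g := by
  obtain ⟨n, hn⟩ := hg
  let e := DoubleQuot.quotQuotEquivQuotOfLEₐ K hle
  have hJ2 : (I₂.map (Ideal.Quotient.mkₐ K I₁)) ^ 2 = ⊥ := by
    have h1 : (I₂ ^ 2).map (Ideal.Quotient.mk I₁) = ⊥ := by
      rw [← le_bot_iff, ← Ideal.map_quotient_self I₁]
      exact Ideal.map_mono hsq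
    rw [Ideal.map_pow] at h1
    exact h1
  obtain ⟨g', hg'n, hg'⟩ := h (B ⧸ I₁) _ hJ2 (e.symm.toAlgHom.comp g) ⟨n, fun a ha => by
    have : g a = 0 := hn ha
    rw [RingHom.mem_ker, AlgHom.comp_apply, this, map_zero]⟩
  refine ⟨g', hg'n, ?_⟩
  rw [← DoubleQuot.quotQuotEquivQuotOfLEₐ_comp_mkₐ K hle, AlgHom.comp_assoc, hg']
  ext a
  exact e.apply_symm_apply (g a)

/-- A continuous homomorphism of a formally smooth algebra to `B ⧸ I²` lifts to all `B ⧸ Iᵏ`. -/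
theorem exists_lift_truncation {A : Type v} [CommRing A] [Algebra K A] {J : Ideal A}
    (h : IsAdicFormallySmooth K J) {B : Type (max u v)} [CommRing B] [Algebra K B] (I : Ideal B)
    (f : A →ₐ[K] B ⧸ I ^ 2) (hf : ∃ n, J ^ n ≤ RingHom.ker f) (k : ℕ) :
    ∃ g : A →ₐ[K] B ⧸ I ^ (k + 2), (∃ n, J ^ n ≤ RingHom.ker g) ∧
      (Ideal.Quotient.factorₐ K (Ideal.pow_le_pow_right (Nat.le_add_left 2 k))).comp g = f := by
  induction k with
  | zero =>
    refine ⟨f, hf, ?_⟩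
    rw [Ideal.Quotient.factorₐ_refl, AlgHom.id_comp]
  | succ k ih =>
    obtain ⟨g, hgn, hg⟩ := ih
    have hle : I ^ (k + 1 + 2) ≤ I ^ (k + 2) := Ideal.pow_le_pow_right (by omega)
    have hsq : (I ^ (k + 2)) ^ 2 ≤ I ^ (k + 1 + 2) := by
      rw [← pow_mul]
      exact Ideal.pow_le_pow_right (by omega)
    obtain ⟨g', hg'n, hg'⟩ := exists_lift_quotient_of_sq_le h hle hsq g hgn
    refine ⟨g', hg'n, ?_⟩
    rw [← hg, ← hg', ← AlgHom.comp_assoc, Ideal.Quotient.factorₐ_comp]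

/-- The functionals `l j` define the first-order map `D`, with `D (f j) = X j` modulo `I ^ 2`; it is
multiplicative because they kill products of augmentation elements. Through `τ` it extends to `A`,
and smoothness lifts it to every order. A relation `P` between the `f j` then holds to any order
between lifts `y j` tangent to `X j`, so `P = 0`. -/
theorem algebraicIndependent_of_isAdicFormallySmooth {R : Type*} {A : Type v} [CommRing R]
    [CommRing A] [Algebra K R] [Algebra K A] (i : R →ₐ[K] A) (ε : R →ₐ[K] K)
    {J : Ideal A} (hsmooth : IsAdicFormallySmooth K J)
    (hτ : ∃ τ : A →ₐ[K] R ⧸ RingHom.ker ε ^ 2,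
      (∀ r, τ (i r) = Ideal.Quotient.mk _ r) ∧ J ^ 2 ≤ RingHom.ker τ)
    {σ : Type v} [Fintype σ] [DecidableEq σ] (f : σ → R) (hf : ∀ j, ε (f j) = 0)
    (l : σ → R →ₗ[K] K) (hl : ∀ j a b, ε a = 0 → ε b = 0 → l j (a * b) = 0)
    (hlf : ∀ j k, l j (f k) = if j = k then 1 else 0) :
    AlgebraicIndependent K f := by
  set I := idealOfVars σ K with hI
  have hX : ∀ j, (X j : MvPolynomial σ K) ∈ I := fun j => Ideal.subset_span ⟨j, rfl⟩
  let D₀ : R →ₗ[K] MvPolynomial σ K := (Algebra.linearMap K _) ∘ₗ ε.toLinearMap +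
    ∑ j, LinearMap.smulRight (l j ∘ₗ (LinearMap.id - Algebra.linearMap K R ∘ₗ ε.toLinearMap))
      (X j)
  have hD₀ : ∀ r, D₀ r = algebraMap K _ (ε r) + ∑ j, l j (r - algebraMap K R (ε r)) • X j := by
    intro r
    simp [D₀]
  have hD₁ : ∀ r, D₀ r - algebraMap K _ (ε r) ∈ I := by
    intro r
    rw [hD₀, add_sub_cancel_left]
    exact sum_mem fun j _ => Submodule.smul_of_tower_mem _ _ (hX j)
  let D : R →ₐ[K] MvPolynomial σ K ⧸ I ^ 2 :=
    AlgHom.ofLinearMap ((Ideal.Quotient.mkₐ K (I ^ 2)).toLinearMap ∘ₗ D₀)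
      (by
        have : D₀ 1 = 1 := by
          rw [hD₀]
          simp
        simp [this])
      (by
        intro a b
        simp only [LinearMap.comp_apply, AlgHom.toLinearMap_apply]
        rw [← map_mul]
        refine Ideal.Quotient.eq.mpr ?_
        have h1 : ∀ j, l j (a * b - algebraMap K R (ε (a * b))) =
            ε a * l j (b - algebraMap K R (ε b)) + ε b * l j (a - algebraMap K R (ε a)) := by
          intro j
          have h2 : a * b - algebraMap K R (ε (a * b)) =
              (a - algebraMap K R (ε a)) * (b - algebraMap K R (ε b)) +
              (ε a • (b - algebraMap K R (ε b)) + ε b • (a - algebraMap K R (ε a))) := by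
            rw [map_mul, map_mul, Algebra.smul_def, Algebra.smul_def]
            ring
          rw [h2, map_add, hl j _ _ (by simp) (by simp), zero_add, map_add, map_smul, map_smul,
            smul_eq_mul, smul_eq_mul]
        have h3 : D₀ (a * b) - D₀ a * D₀ b = -((D₀ a - algebraMap K _ (ε a)) *
            (D₀ b - algebraMap K _ (ε b))) := by
          have h4 : D₀ (a * b) = algebraMap K _ (ε a) * algebraMap K _ (ε b) +
              (algebraMap K _ (ε a) * (D₀ b - algebraMap K _ (ε b)) +
              algebraMap K _ (ε b) * (D₀ a - algebraMap K _ (ε a))) := by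
            rw [hD₀ (a * b), hD₀ a, hD₀ b, add_sub_cancel_left, add_sub_cancel_left, map_mul,
              map_mul, mul_sum, mul_sum, ← sum_add_distrib]
            congr 1
            refine sum_congr rfl fun j _ => ?_
            rw [← map_mul, h1, add_smul, mul_smul, mul_smul, Algebra.smul_def (ε a),
              Algebra.smul_def (ε b)]
          rw [h4]
          ring
        rw [h3, pow_two]
        exact neg_mem (Ideal.mul_mem_mul (hD₁ a) (hD₁ b)))
  have hDapply : ∀ r, D r = Ideal.Quotient.mk _ (D₀ r) := fun r => rfl
  have hDf : ∀ j, D (f j) = Ideal.Quotient.mk _ (X j) := by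
    intro j
    rw [hDapply, hD₀, hf]
    simp [hlf]
  have hDker : RingHom.ker ε ^ 2 ≤ RingHom.ker D.toRingHom := by
    refine pow_le_ker_of_forall_exists D.toRingHom fun r hr => ⟨D₀ r, ?_, rfl⟩
    have := hD₁ r
    rwa [RingHom.mem_ker.mp hr, map_zero, sub_zero] at this
  obtain ⟨τ, hτi, hτk⟩ := hτ
  let D'' := Ideal.Quotient.liftₐ (RingHom.ker ε ^ 2) D fun r hr => hDker hr
  let D' : A →ₐ[K] MvPolynomial σ K ⧸ I ^ 2 := D''.comp τ
  have hD' : ∀ r, D' (i r) = D r := by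
    intro r
    change D'' (τ (i r)) = _
    rw [hτi]
    rfl
  have hDk : J ^ 2 ≤ RingHom.ker D' := fun a ha => by
    have : τ a = 0 := hτk ha
    rw [RingHom.mem_ker, AlgHom.comp_apply, this, map_zero]
  have hlift := exists_lift_truncation hsmooth I D' ⟨2, hDk⟩
  rw [algebraicIndependent_iff]
  intro P hP
  refine eq_zero_of_forall_exists_aeval_mem fun k => ?_
  obtain ⟨g, -, hg⟩ := hlift k
  choose y hy using fun j => Ideal.Quotient.mk_surjective (g (i (f j)))
  refine ⟨y, fun j => ?_, ?_⟩
  · rw [← Ideal.Quotient.eq, ← hDf, ← hD', ← hg, AlgHom.comp_apply, ← hy]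
    rfl
  · refine Ideal.pow_le_pow_right (Nat.le_add_right k 2) ?_
    rw [← Ideal.Quotient.eq_zero_iff_mem]
    have h1 : Ideal.Quotient.mkₐ K (I ^ (k + 2)) (aeval y P) = (g.comp i) (aeval f P) := by
      rw [comp_aeval_apply, comp_aeval_apply]
      congr 2
      exact funext hy
    rw [hP, map_zero] at h1
    exact h1

end Lifting

variable {K : Type u} {V : Type v} [Field K] [AddCommGroup V] [Module K V] [FiniteDimensional K V]
  (Δ : Subgroup (LinearMap.GeneralLinearGroup K V)) [Fintype Δ]

theorem isAdicFormallySmooth_of_isPolynomialAlgebra (hΔ : (Fintype.card Δ : K) ≠ 0)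
    (h : IsPolynomialAlgebra K (symInvariants Δ)) :
    IsAdicFormallySmooth K (invariantsMaxIdeal Δ) := by
  obtain ⟨n, ⟨e⟩⟩ := h
  have := Algebra.FormallySmooth.of_equiv e
  refine isAdicFormallySmooth_of_formallySmooth (toCompletedInvariants Δ)
    (I := symInvariantsIdeal Δ) ?_ (exists_sub_mem_pow Δ hΔ) (exists_truncation Δ hΔ)
  have := map_toCompletedInvariants_le Δ 1
  rwa [pow_one, pow_one] at this

theorem cotangentRankLE_of_isAdicFormallySmooth (hΔ : (Fintype.card Δ : K) ≠ 0)
    (h : IsAdicFormallySmooth K (invariantsMaxIdeal Δ)) :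
    CotangentRankLE (symInvariants Δ) (Module.finrank K V) := by
  intro m f hf hli
  set M := posPart (symInvariants Δ) * posPart (symInvariants Δ)
  obtain ⟨π, hπ⟩ := LinearMap.exists_leftInverse_of_injective _ (LinearMap.ker_eq_bot.mpr hli)
  -- The lift places the polynomial ring in the universe of the test algebras.
  let σ := ULift.{max u v} (Fin m)
  let f' : σ → symInvariants Δ := fun j => ⟨f j.down, (hf j.down).1⟩
  let l : σ → symInvariants Δ →ₗ[K] K := fun j =>
    Finsupp.lapply j.down ∘ₗ π ∘ₗ M.mkQ ∘ₗ (symInvariants Δ).val.toLinearMap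
  have hl : ∀ j (a b : symInvariants Δ), SymmetricAlgebra.algebraMapInv (a : SymmetricAlgebra K V) = (0 : K) →
      SymmetricAlgebra.algebraMapInv (b : SymmetricAlgebra K V) = (0 : K) → l j (a * b) = 0 := by
    intro j a b ha hb
    have h1 : M.mkQ ((a : SymmetricAlgebra K V) * b) = 0 :=
      (Submodule.Quotient.mk_eq_zero _).mpr (Submodule.mul_mem_mul ⟨a.2, ha⟩ ⟨b.2, hb⟩)
    change (π (M.mkQ ((a : SymmetricAlgebra K V) * b))) j.down = 0
    rw [h1, map_zero, Finsupp.zero_apply]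
  have hlf : ∀ j k, l j (f' k) = if j = k then 1 else 0 := by
    intro j k
    have h1 := LinearMap.congr_fun hπ (Finsupp.single k.down 1)
    simp only [LinearMap.comp_apply, Finsupp.linearCombination_single, one_smul,
      LinearMap.id_apply] at h1
    change (π (M.mkQ (f k.down))) j.down = _
    rw [h1, Finsupp.single_apply]
    by_cases hjk : j = k
    · rw [if_pos hjk, if_pos (congrArg ULift.down hjk).symm]
    · rw [if_neg hjk, if_neg fun h => hjk (ULift.ext _ _ h.symm)]
  have hind := algebraicIndependent_of_isAdicFormallySmooth (toCompletedInvariants Δ)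
    ((SymmetricAlgebra.algebraMapInv (R := K) (M := V)).comp (symInvariants Δ).val) h
    (exists_truncation Δ hΔ 2) f' (fun j => (hf j.down).2) l hl hlf
  have hind' : AlgebraicIndependent K fun j => (f' j : SymmetricAlgebra K V) :=
    hind.map' (f := (symInvariants Δ).val) Subtype.val_injective
  have h1 := hind'.lift_cardinalMk_le_trdeg
  rw [lift_trdeg_symmetricAlgebra] at h1
  simpa [σ] using h1

end CST

end

/-! ### The cycle of implications. -/

theorem mainTheorem10 {K : Type u} {V : Type v} [Field K] [AddCommGroup V] [Module K V]
    [FiniteDimensional K V] (Δ : Subgroup (LinearMap.GeneralLinearGroup K V)) [Finite Δ]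
    (hΔ : IsUnit (Nat.card Δ : K)) :
    List.TFAE [
      Subgroup.closure {g | g ∈ Δ ∧ CST.IsPseudoreflection g} = Δ,
      CST.IsPolynomialAlgebra K (CST.symInvariants Δ),
      Module.Free (CST.symInvariants Δ) (SymmetricAlgebra K V),
      CST.IsAdicFormallySmooth K (CST.invariantsMaxIdeal Δ)] := by
  have := Fintype.ofFinite Δ
  have hcard : (Fintype.card Δ : K) ≠ 0 := by
    rw [← Nat.card_eq_fintype_card]
    exact hΔ.ne_zero
  tfae_have 1 → 3 := CST.free_of_closure_pseudoreflection Δ hcard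
  tfae_have 3 → 2 := fun h => CST.isPolynomialAlgebra_of_cotangentRankLE Δ
    fun m f hf hli => CST.card_le_finrank_of_free Δ f hf hli
  tfae_have 2 → 4 := CST.isAdicFormallySmooth_of_isPolynomialAlgebra Δ hcard
  tfae_have 4 → 1 := fun h => CST.closure_pseudoreflection_of_cotangentRankLE Δ hΔ.ne_zero
    (CST.cotangentRankLE_of_isAdicFormallySmooth Δ hcard h)
  tfae_finish
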